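/- **Setting.** Let $K$ be a field (the paper has $K=\mathbb C$), let $e=(e_i)_{i}$ be a finite family of non-negative integers and $b\ge 0$. The scroll of type $e$ has coordinates $z_{i,j}=s^{e_i-j}t^jz_i$ $(0\le j\le e_i)$ and is given by the minors of the matrix with columns $(z_\alpha,z_{\alpha+1})=(z_{i,j},z_{i,j+1})$, $0\le j<e_i$. Let $$P=\sum_{|I|=2}\ \sum_{k=0}^{\langle e,I\rangle-b}p_{I,k}\,s^{\langle e,I\rangle-b-k}t^kz^I,\qquad p_{I,k}\in K,$$ define a divisor of type $2H-bR$. *Additional equations* $P_0,\dots,P_b$ obtained by rolling factors are quadratic forms in the $z_{i,j}$ which restrict on the scroll to $s^{b-m}t^mP$ and satisfy $P_m=\sum_\alpha p_{\alpha,m}z_\alpha$, $P_{m+1}=\sum_\alpha p_{\alpha,m}z_{\alpha+1}$ with linear forms $p_{\alpha,m}$. The scroll is deformed by the parameters $\zeta_{i,j}$ $(1\le j\le e_i-1)$: the columns become $(z_\alpha,z_{\alpha+1}+\zeta_{\alpha+1})$. Put $\zeta_{i,j}=0$ for all other $j$. For each $i$ with $e_i\ge b$ there are pure rolling factors parameters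 $\rho_{i,0},\dots,\rho_{i,e_i-b}$. Let $L\subset K[\zeta,\rho]$ be the ideal of the lifting conditions $$\sum_l\sum_{j=0}^{e_i+e_l-b}(1+\delta_{il})\,p_{\{i,l\},j}\,\zeta_{l,j+n}=0,\qquad 0<n<b-e_i.$$ An *infinitesimal rolling factors deformation* of $P_0,\dots,P_b$ consists of perturbations $$P_m'(z,\zeta,\rho)=Q_m(z,\zeta)+\sum_{i}\sum_{j=0}^{e_i-b}\rho_{i,j}z_{i,j+m}$$ with $Q_m$ bilinear over $K$ in $z$ and $\zeta$, such that on the scroll $sP'_{m+1}-tP'_m-s\sum_\alpha p_{\alpha,m}\zeta_{\alpha+1}\equiv 0$ modulo $L$ for $0\le m<b$. Its *base equations* are $P_m'(\zeta,\zeta,\rho)-P_m(\zeta)$, $1\le m\le b-1$ (every $z_{i,j}$ is replaced by $\zeta_{i,j}$). It *extends over the subspace defined by an ideal* $J\subset K[\zeta,\rho]$ if there are $c_m\in K[\zeta,\rho]$ such that the equations $\tilde P_m=P_m+P'_m+c_m$ are in rolling factors with respect to the deformed scroll, that is, $\tilde P_{m+1}z_\beta-\tilde P_m(z_{\beta+1}+\zeta_{\beta+1})$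 lies, modulo $J$, in the ideal of the deformed scroll for all $0\le m<b$ and all columns $\beta$. **The formula.** For each $I$ choose a way to write $z^I=xy$ with $e_x\ge e_y$, and write $\xi_l=\zeta_{x,l}$, $\eta_l=\zeta_{y,l}$. For $1\le m\le b-1$ let $$\pi_m=\sum_{I,k}p_{I,k}\,T_{I,k,m}+\sum_{i:\,e_i\ge b}\bigl(\rho_{i,0}\zeta_{i,m}+\cdots+\rho_{i,e_i-b}\zeta_{i,m+e_i-b}\bigr),$$ where $T_{I,k,m}$ is as follows. I. If $e_x<b$, then for $m\le k$ it is $-\sum_{l=m}^{k}\eta_{k-l+m}\xi_l$, and for $m>k$ it is $$\sum_{l=\max(k+m-e_y+1,\,k+1)}^{\min(e_x-1,\,m-1)}\eta_{k-l+m}\xi_l .$$ II. If $e_x\ge b$, then for $m\le k+b-e_x$ it is $-\sum_{l=m+e_x-b}^{k}\eta_{k-l+m}\xi_l$, and for $m>k+b-e_x$ it is $$\sum_{l=\max(k+m-e_y+1,\,k+1)}^{\min(e_x-b+m-1,\,k+m-1)}\eta_{k-l+m}\xi_l .$$ **Theorem.** 1. There are additional equations $P_m$ and an infinitesimal rolling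 factors deformation $P'_m$ whose base equations are exactly $\pi_1,\dots,\pi_{b-1}$. 2. For every choice of additional equations $P_m$ and every infinitesimal rolling factors deformation $P'_m$ of them, the following holds. (a) The deformation extends over the subspace defined by $J$ if and only if $J$ contains $L$ and all its base equations; so $L$ and the $b-1$ base equations define the maximal extension. (b) There are $K$-linear forms $\tau_{i,j}$ in the $\zeta$'s such that, after the coordinate transformation $\rho_{i,j}\mapsto\rho_{i,j}+\tau_{i,j}$ in $\pi_m$, the $m$-th base equation is congruent to $\pi_m$ modulo $L$, for all $1\le m\le b-1$. -/

import Mathlib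

noncomputable section

namespace RollingFactors

open MvPolynomial

variable {ι : Type*}

/-! ### The scroll

The scroll has one block of columns for each `i : ι`, of degree `e i` (which may be `0`).  Its ambient
projective space has coordinates `z_{i,j}`, `0 ≤ j ≤ e i`, and its matrix has the columns
`(z_{i,j}, z_{i,j+1})`, `0 ≤ j < e i`. -/

/-- Indices `(i, j)` with `0 ≤ j ≤ e i` of the coordinates on projective space. -/
abbrev Coord (e : ι → ℕ) : Type _ := (i : ι) × Fin (e i + 1)

/-- Indices `α = (i, j)` with `0 ≤ j < e i` of the columns of the matrix of the scroll. -/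
abbrev Column (e : ι → ℕ) : Type _ := (i : ι) × Fin (e i)

/-- The coordinate in the top row of the column `α = (i, j)`, i.e. `z_α = z_{i,j}`. -/
def zTop (R : Type*) [CommRing R] (e : ι → ℕ) (α : Column e) : MvPolynomial (Coord e) R :=
  X ⟨α.1, α.2.castSucc⟩

/-- The coordinate in the bottom row of the column `α = (i, j)`, i.e. `z_{α+1} = z_{i,j+1}`. -/
def zBot (R : Type*) [CommRing R] (e : ι → ℕ) (α : Column e) : MvPolynomial (Coord e) R :=
  X ⟨α.1, α.2.succ⟩

/-- The bihomogeneous coordinate ring `R[s, t; z_i]`. -/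
abbrev Cox (ι : Type*) (R : Type*) [CommRing R] : Type _ := MvPolynomial (Fin 2 ⊕ ι) R

/-- The coordinate `s` on the projective line. -/
def sVar (ι : Type*) (R : Type*) [CommRing R] : Cox ι R := X (Sum.inl 0)

/-- The coordinate `t` on the projective line. -/
def tVar (ι : Type*) (R : Type*) [CommRing R] : Cox ι R := X (Sum.inl 1)

/-- Restriction to the scroll: `z_{i,j} ↦ s ^ (e i - j) t ^ j z_i`. -/
def onScroll (R : Type*) [CommRing R] (e : ι → ℕ) :
    MvPolynomial (Coord e) R →ₐ[R] Cox ι R :=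
  aeval fun c => sVar ι R ^ (e c.1 - (c.2 : ℕ)) * tVar ι R ^ (c.2 : ℕ) * X (Sum.inr c.1)

/-! ### A divisor of type `2H - bR` and its equations by rolling factors

A multi-index `I` with `|I| = 2` is an unordered pair of elements of `ι`. -/

/-- `⟨e, I⟩`, which is `e x + e y` for `z ^ I = x y`. -/
def deg (e : ι → ℕ) (I : Sym2 ι) : ℕ :=
  Sym2.lift ⟨fun i j => e i + e j, fun i j => Nat.add_comm (e i) (e j)⟩ I

/-- The monomial `z ^ I` in the fibre coordinates. -/
def fibreMonomial (K : Type*) [CommRing K] (I : Sym2 ι) : Cox ι K :=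
  Sym2.lift ⟨fun i j => X (Sum.inr i) * X (Sum.inr j), fun _ _ => mul_comm _ _⟩ I

/-- The `k` with `0 ≤ k ≤ ⟨e, I⟩ - b` (none if `⟨e, I⟩ < b`). -/
def coeffRange (e : ι → ℕ) (b : ℕ) (I : Sym2 ι) : Finset ℕ :=
  Finset.range (deg e I + 1 - b)

/-- `P = ∑ p_{I,k} s ^ (⟨e,I⟩ - b - k) t ^ k z ^ I`. -/
def divisorEq {K : Type*} [Field K] [Fintype ι] [DecidableEq ι] (e : ι → ℕ) (b : ℕ)
    (p : Sym2 ι → ℕ → K) : Cox ι K :=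
  ∑ I : Sym2 ι, ∑ k ∈ coeffRange e b I,
    C (p I k) * sVar ι K ^ (deg e I - b - k) * tVar ι K ^ k * fibreMonomial K I

/-- Additional equations `P_0, …, P_b` for the divisor of `P`, obtained by rolling factors:
`P_m` is a quadratic form in the `z_{i,j}` which restricts to `s ^ (b-m) t ^ m P`, and
`P_m = ∑ p_{α,m} z_α`, `P_{m+1} = ∑ p_{α,m} z_{α+1}`, the sum being over the columns. -/
structure RollingSystem {K : Type*} [Field K] [Fintype ι] [DecidableEq ι] (e : ι → ℕ) (b : ℕ)
    (p : Sym2 ι → ℕ → K) where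
  /-- the equation `P_m` (only `m ≤ b` matters) -/
  eqn : ℕ → MvPolynomial (Coord e) K
  /-- the linear form `p_{α,m}` (only `m < b` matters) -/
  fac : ℕ → Column e → MvPolynomial (Coord e) K
  eqn_homogeneous : ∀ m ≤ b, (eqn m).IsHomogeneous 2
  eqn_onScroll : ∀ m ≤ b,
    onScroll K e (eqn m) = sVar ι K ^ (b - m) * tVar ι K ^ m * divisorEq e b p
  fac_homogeneous : ∀ m < b, ∀ α, (fac m α).IsHomogeneous 1
  eqn_eq : ∀ m < b, eqn m = ∑ α, fac m α * zTop K e α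
  eqn_succ : ∀ m < b, eqn (m + 1) = ∑ α, fac m α * zBot K e α

/-! ### Deformation parameters -/

/-- Parameters `ζ_{i,j}` with `1 ≤ j ≤ e i - 1` of the scroll; `⟨i, j⟩` stands for `ζ_{i,j+1}`. -/
abbrev ScrollParam (e : ι → ℕ) : Type _ := (i : ι) × Fin (e i - 1)

/-- Parameters `ρ_{i,j}` with `0 ≤ j ≤ e i - b` of the pure rolling factors deformations
(none for `i` if `e i < b`). -/
abbrev PureParam (e : ι → ℕ) (b : ℕ) : Type _ := (i : ι) × Fin (e i + 1 - b)

/-- The polynomial ring `K[ζ, ρ]` of all deformation parameters. -/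
abbrev Params (K : Type*) [Field K] (e : ι → ℕ) (b : ℕ) : Type _ :=
  MvPolynomial (ScrollParam e ⊕ PureParam e b) K

/-- `ζ_{i,j}`, which is `0` unless `1 ≤ j ≤ e i - 1`. -/
def zeta (K : Type*) [Field K] (e : ι → ℕ) (b : ℕ) (i : ι) (j : ℕ) : Params K e b :=
  if h : 1 ≤ j ∧ j < e i then X (Sum.inl ⟨i, ⟨j - 1, by omega⟩⟩) else 0

/-- `ρ_{i,j}`, which is `0` unless `0 ≤ j ≤ e i - b`. -/
def rho (K : Type*) [Field K] (e : ι → ℕ) (b : ℕ) (i : ι) (j : ℕ) : Params K e b :=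
  if h : j + b ≤ e i then X (Sum.inr ⟨i, ⟨j, by omega⟩⟩) else 0

/-- The `K`-linear form in the `ζ_{i,j}` with given coefficients. -/
def linForm {K : Type*} [Field K] [Fintype ι] (e : ι → ℕ) (b : ℕ) (c : ScrollParam e → K) :
    Params K e b :=
  ∑ a, C (c a) * X (Sum.inl a)

/-- The left hand side of the lifting equation for `z_i` (a multi-index of degree one) and `n`:
`∑_l ∑_j (i_l + 1) p_{I + δ_l, j} ζ_{l, j + n}` with `I = δ_i`. -/
def liftingForm {K : Type*} [Field K] [Fintype ι] [DecidableEq ι] (e : ι → ℕ) (b : ℕ)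
    (p : Sym2 ι → ℕ → K) (i : ι) (n : ℕ) : Params K e b :=
  ∑ l, ∑ j ∈ coeffRange e b s(i, l),
    C ((if l = i then 2 else 1) * p s(i, l) j) * zeta K e b l (j + n)

/-- The ideal of the lifting conditions, `0 < n < b - e i`. -/
def liftingIdeal {K : Type*} [Field K] [Fintype ι] [DecidableEq ι] (e : ι → ℕ) (b : ℕ)
    (p : Sym2 ι → ℕ → K) : Ideal (Params K e b) :=
  Ideal.span {f | ∃ (i : ι) (n : ℕ), 0 < n ∧ n + e i < b ∧ f = liftingForm e b p i n}

/-! ### Infinitesimal rolling factors deformations -/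

section Deformations

variable {K : Type*} [Field K] [Fintype ι] [DecidableEq ι] {e : ι → ℕ} {b : ℕ}
  {p : Sym2 ι → ℕ → K}

/-- The perturbation `P'_m(z, ζ, ρ) = ∑_{i,j} (∑_a c_{m,(i,j),a} ζ_a) z_{i,j} + ∑_{i,j} ρ_{i,j} z_{i,j+m}`
for `m ≤ b`: bilinear in `z` and `ζ`, plus the general pure rolling factors deformation. -/
def perturbation (e : ι → ℕ) (b : ℕ) (c : ℕ → Coord e → ScrollParam e → K) (m : ℕ) :
    MvPolynomial (Coord e) (Params K e b) :=
  ∑ d : Coord e, C (linForm e b (c m d)) * X d +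
    ∑ i, ∑ j ∈ Finset.range (e i + 1 - b),
      if h : j + m ≤ e i then C (rho K e b i j) * X ⟨i, ⟨j + m, by omega⟩⟩ else 0

/-- The entry `z_{α+1} + ζ_{α+1}` in the bottom row of the matrix of the deformed scroll; the top row
has the entries `z_α`. -/
def defBot (K : Type*) [Field K] (e : ι → ℕ) (b : ℕ) (α : Column e) :
    MvPolynomial (Coord e) (Params K e b) :=
  zBot (Params K e b) e α + C (zeta K e b α.1 ((α.2 : ℕ) + 1))

/-- The ideal of the deformed scroll, generated by the `2 × 2` minors of the deformed matrix. -/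
def defScrollIdeal (K : Type*) [Field K] (e : ι → ℕ) (b : ℕ) :
    Ideal (MvPolynomial (Coord e) (Params K e b)) :=
  Ideal.span {f | ∃ α β : Column e,
    f = zTop (Params K e b) e α * defBot K e b β - defBot K e b α * zTop (Params K e b) e β}

/-- An infinitesimal rolling factors deformation of the equations `P_m`: perturbations `P'_m` which
satisfy `s P'_{m+1} - t P'_m - s ∑ p_{α,m} ζ_{α+1} = 0` on the scroll, modulo the lifting conditions. -/
structure InfDeformation (S : RollingSystem e b p) where
  /-- the coefficients of the part of `P'_m` that is bilinear in `z` and `ζ` -/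
  coeffs : ℕ → Coord e → ScrollParam e → K
  lifts : ∀ m < b,
    sVar ι (Params K e b) * onScroll (Params K e b) e (perturbation e b coeffs (m + 1))
      - tVar ι (Params K e b) * onScroll (Params K e b) e (perturbation e b coeffs m)
      - sVar ι (Params K e b) * onScroll (Params K e b) e
          (∑ α, map C (S.fac m α) * C (zeta K e b α.1 ((α.2 : ℕ) + 1)))
      ∈ (liftingIdeal e b p).map (C : Params K e b →+* Cox ι (Params K e b))

/-- The base equation `P'_m(ζ, ζ, ρ) - P_m(ζ)`; here `z_{i,j}` is replaced by `ζ_{i,j}`, with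
`ζ_{i,0} = ζ_{i,e i} = 0`. -/
def InfDeformation.baseEq {S : RollingSystem e b p} (D : InfDeformation S) (m : ℕ) : Params K e b :=
  eval (fun d : Coord e => zeta K e b d.1 (d.2 : ℕ)) (perturbation e b D.coeffs m)
    - aeval (fun d : Coord e => zeta K e b d.1 (d.2 : ℕ)) (S.eqn m)

/-- The infinitesimal deformation extends over the subspace of the parameter space defined by the ideal
`J`: there are terms `c_m`, constant in `z`, such that the equations `P_m + P'_m + c_m` are in rolling
factors with respect to the deformed scroll, i.e. the rolling factors relations between `P_m` and
`P_{m+1}` lift. -/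
def InfDeformation.ExtendsOver {S : RollingSystem e b p} (D : InfDeformation S)
    (J : Ideal (Params K e b)) : Prop :=
  ∃ c : ℕ → Params K e b, ∀ m < b, ∀ β : Column e,
    (map C (S.eqn (m + 1)) + perturbation e b D.coeffs (m + 1) + C (c (m + 1)))
          * zTop (Params K e b) e β
        - (map C (S.eqn m) + perturbation e b D.coeffs m + C (c m)) * defBot K e b β
      ∈ defScrollIdeal K e b ⊔ J.map (C : Params K e b →+* MvPolynomial (Coord e) (Params K e b))

end Deformations

/-! ### The explicit formula -/

/-- The term that `p_{I,k}`, with `z ^ I = x y` and `e x ≥ e y`, gives in `π_m`.  With `ξ_l = ζ_{x,l}` and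
`η_l = ζ_{y,l}` every summand is `η_{k-l+m} ξ_l`; `l ≤ k + m` in all of the sums. -/
def term (K : Type*) [Field K] (e : ι → ℕ) (b : ℕ) (x y : ι) (k m : ℕ) : Params K e b :=
  if e x < b then
    if m ≤ k then
      -∑ l ∈ Finset.Icc m k, zeta K e b y (k + m - l) * zeta K e b x l
    else
      ∑ l ∈ Finset.Icc (max (k + m + 1 - e y) (k + 1)) (min (e x - 1) (m - 1)),
        zeta K e b y (k + m - l) * zeta K e b x l
  else
    if m + e x ≤ k + b then
      -∑ l ∈ Finset.Icc (m + e x - b) k, zeta K e b y (k + m - l) * zeta K e b x l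
    else
      ∑ l ∈ Finset.Icc (max (k + m + 1 - e y) (k + 1)) (min (e x - b + m - 1) (k + m - 1)),
        zeta K e b y (k + m - l) * zeta K e b x l

/-- The polynomial `π_m`: the terms of all coefficients `p_{I,k}`, where `z ^ I = z_{x I} z_{y I}`, and
the contributions `r_{i,0} ζ_{i,m} + ⋯ + r_{i,e i - b} ζ_{i,m+e i-b}` for all `i` with `e i ≥ b`. -/
def basePoly {K : Type*} [Field K] [Fintype ι] [DecidableEq ι] (e : ι → ℕ) (b : ℕ)
    (p : Sym2 ι → ℕ → K) (x y : Sym2 ι → ι) (r : ι → ℕ → Params K e b) (m : ℕ) : Params K e b :=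
  ∑ I : Sym2 ι, ∑ k ∈ coeffRange e b I, C (p I k) * term K e b (x I) (y I) k m
    + ∑ i, ∑ j ∈ Finset.range (e i + 1 - b), r i j * zeta K e b i (j + m)

end RollingFactors

end

noncomputable section

namespace RollingFactors

open MvPolynomial

/-! ### Linear functionals on quadratic forms -/

/-! For every choice of additional equations there is one explicit deformation, `stdDeformation`,
with which all others are compared. Taking coefficients of `z_{i,j}`, the condition on `P'_m`
becomes a recursion along the diagonals `(m, j) → (m+1, j+1)`, an initial value at `j = 0` and
vanishing at `j = e i` (`mem_iff_isLift`).

The standard solution sends each monomial `z_{i,a} z_{l,c}` of `P_m` to the tail `∑_{J ≥ a}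
ζ_{l,a+c-J} z_{i,J}` plus the tail with the two factors exchanged. Rolling a factor moves both tails
along the diagonals, except for one new term, which is exactly the one prescribed by `∑ p_{α,m}
ζ_{α+1}` (`polarTail_botCoord`). At `J = e i` the tails depend only on `a + c`, hence only on the
restriction to the scroll: they give a lifting form if `m > e i`, and are cancelled by `correction`
otherwise (`stdCoeff_last`).

At `z = ζ` the two tails together run through the full convolution `∑_J ζ_{i,J} ζ_{l,a+c-J}`, with
one summand counted twice; the surplus is the monomial of `P_m(ζ)` (`sum_polarTail_mul_zeta`). So
the base equations depend only on `P`, and with the corrections they become `π_m` (`term_eq`).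

Modulo `L`, the difference between any deformation and the standard one is constant along diagonals.
It vanishes on diagonals that enter at `j = 0` with `m > 0`, or that reach `j = e i` at some `m <
b`. The remaining ones start at `(0, k)` with `k ≤ e i - b` and are absorbed by the `ρ_{i,k}`.

For the extension, linear forms that satisfy the relation on the scroll fail to do so on the
deformed scroll by a constant `σ_m` (`IsLift.mem`), which is congruent to the base equation of index
`m + 1`. Lifting the `m`-th relation forces `c_m = 0` and `c_{m+1} = σ_m` modulo `J`
(`isLift_of_mem`). The two demands meet on `c_m` for `1 ≤ m ≤ b - 1`, which gives the base
equations; `c_0` and `c_b` cause no obstruction. -/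

section QuadraticFunctionals

variable {σ ι K A : Type*} [CommRing K] [AddCommGroup A] [Module K A]

open Classical in
/-- The value at the exponent of `X c * X d` is `Φ c d`; it is `0` at exponents of other degrees. -/
def quadValue (Φ : σ → σ → A) (s : σ →₀ ℕ) : A :=
  if h : ∃ c : σ × σ, s = Finsupp.single c.1 1 + Finsupp.single c.2 1 then
    Φ h.choose.1 h.choose.2 else 0

lemma eq_or_eq_swap_of_single_add_single_eq {c d c' d' : σ}
    (h : (Finsupp.single c 1 + Finsupp.single d 1 : σ →₀ ℕ)
      = Finsupp.single c' 1 + Finsupp.single d' 1) :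
    c = c' ∧ d = d' ∨ c = d' ∧ d = c' := by
  classical
  have h2 := congrArg Finsupp.toMultiset h
  simp only [map_add, Finsupp.toMultiset_single, one_smul, Multiset.singleton_add] at h2
  rcases Multiset.cons_eq_cons.1 h2 with ⟨h3, h4⟩ | ⟨_, t, h4, h5⟩
  · exact Or.inl ⟨h3, Multiset.singleton_inj.1 h4⟩
  · obtain ⟨h6, rfl⟩ := Multiset.singleton_eq_cons_iff _ |>.1 h4
    obtain ⟨h7, -⟩ := Multiset.singleton_eq_cons_iff _ |>.1 h5
    exact Or.inr ⟨h7.symm, h6⟩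

/-- An exponent of degree two determines its pair of variables up to order, so for symmetric `Φ` the
chosen pair does not matter. -/
lemma quadValue_single_add_single {Φ : σ → σ → A} (hΦ : ∀ c d, Φ c d = Φ d c) (c d : σ) :
    quadValue Φ (Finsupp.single c 1 + Finsupp.single d 1) = Φ c d := by
  have h : ∃ a : σ × σ, (Finsupp.single c 1 + Finsupp.single d 1 : σ →₀ ℕ)
      = Finsupp.single a.1 1 + Finsupp.single a.2 1 := ⟨(c, d), rfl⟩
  rw [quadValue, dif_pos h]
  rcases eq_or_eq_swap_of_single_add_single_eq h.choose_spec with ⟨h1, h2⟩ | ⟨h1, h2⟩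
  · rw [← h1, ← h2]
  · rw [← h1, ← h2, hΦ]

variable (K) in
/-- The linear functional which sends `X c * X d` to `Φ c d`, for symmetric `Φ`. -/
def quadForm (Φ : σ → σ → A) : MvPolynomial σ K →ₗ[K] A :=
  (basisMonomials σ K).constr K (quadValue Φ)

lemma quadForm_X_mul_X {Φ : σ → σ → A} (hΦ : ∀ c d, Φ c d = Φ d c) (c d : σ) :
    quadForm K Φ (X c * X d) = Φ c d := by
  have h : (X c * X d : MvPolynomial σ K)
      = basisMonomials σ K (Finsupp.single c 1 + Finsupp.single d 1) := by
    simp [X, monomial_mul]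
  rw [h, quadForm, Module.Basis.constr_basis, quadValue_single_add_single hΦ]

variable (K) in
/-- The linear functional which sends `s ^ a * t ^ N * z_i * z_l` to `Ψ i l N`, for `Ψ` symmetric in
`i` and `l`. -/
def scrollForm (Ψ : ι → ι → ℕ → A) : Cox ι K →ₗ[K] A :=
  (basisMonomials (Fin 2 ⊕ ι) K).constr K fun s =>
    quadValue (fun i l => Ψ i l (s (Sum.inl 1)))
      (s.comapDomain Sum.inr Sum.inr_injective.injOn)

lemma scrollForm_apply {Ψ : ι → ι → ℕ → A} (hΨ : ∀ i l N, Ψ i l N = Ψ l i N) (a N : ℕ) (i l : ι) :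
    scrollForm K Ψ (sVar ι K ^ a * tVar ι K ^ N * (X (Sum.inr i) * X (Sum.inr l))) = Ψ i l N := by
  have h : (sVar ι K ^ a * tVar ι K ^ N * (X (Sum.inr i) * X (Sum.inr l)) : Cox ι K)
      = basisMonomials _ K (Finsupp.single (Sum.inl 0) a + Finsupp.single (Sum.inl 1) N
        + (Finsupp.single (Sum.inr i) 1 + Finsupp.single (Sum.inr l) 1)) := by
    simp [sVar, tVar, X_pow_eq_monomial]
    simp [X, monomial_mul]
  rw [h, scrollForm, Module.Basis.constr_basis]
  have h1 : ∀ f : Fin 2 ⊕ ι →₀ ℕ, ∀ g : ι →₀ ℕ, (∀ j, f (Sum.inr j) = g j) →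
      f.comapDomain Sum.inr Sum.inr_injective.injOn = g := fun f g hfg => by
    ext j; simpa using hfg j
  rw [h1 _ (Finsupp.single i 1 + Finsupp.single l 1) fun j => by
    classical simp [Finsupp.single_apply]]
  rw [quadValue_single_add_single fun c d => hΨ _ _ _]
  simp

end QuadraticFunctionals

lemma eq_sum_of_isHomogeneous_one {σ R : Type*} [Fintype σ] [CommRing R] {f : MvPolynomial σ R}
    (hf : f.IsHomogeneous 1) : f = ∑ d, coeff (Finsupp.single d 1) f • X d := by
  classical
  have h : f ∈ homogeneousSubmodule σ R 1 := hf
  rw [homogeneousSubmodule_one_eq_span_X] at h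
  obtain ⟨c, rfl⟩ := (Submodule.mem_span_range_iff_exists_fun R).1 h
  refine Finset.sum_congr rfl fun d _ => ?_
  simp [coeff_sum, coeff_X, Finsupp.single_left_inj]

lemma deg_eq {ι : Type*} (e : ι → ℕ) {x y : Sym2 ι → ι} (hxy : ∀ I, s(x I, y I) = I) (I : Sym2 ι) :
    deg e I = e (x I) + e (y I) := by
  conv_lhs => rw [← hxy I]
  rfl

lemma fibreMonomial_eq (K : Type*) [CommRing K] {ι : Type*} {x y : Sym2 ι → ι} (hxy : ∀ I, s(x I, y I) = I) (I : Sym2 ι) :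
    fibreMonomial K I = X (Sum.inr (x I)) * X (Sum.inr (y I)) := by
  conv_lhs => rw [← hxy I]
  rfl

/-! ### Quadratic functionals evaluated on the additional equations -/

section StandardDeformation

variable {K : Type*} [Field K] {ι : Type*} [Fintype ι] [DecidableEq ι] {e : ι → ℕ} {b : ℕ}
  {p : Sym2 ι → ℕ → K} {A : Type*} [AddCommGroup A] [Module K A]

/-- The index of the coordinate `z_α` in the top row of the column `α`. -/
abbrev topCoord (α : Column e) : Coord e := ⟨α.1, α.2.castSucc⟩

/-- The index of the coordinate `z_{α+1}` in the bottom row of the column `α`. -/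
abbrev botCoord (α : Column e) : Coord e := ⟨α.1, α.2.succ⟩

/-- The coefficient of `z_d` in the linear form `p_{α,m}`. -/
def RollingSystem.facCoeff (S : RollingSystem e b p) (m : ℕ) (α : Column e) (d : Coord e) : K :=
  coeff (Finsupp.single d 1) (S.fac m α)

lemma RollingSystem.fac_eq_sum (S : RollingSystem e b p) {m : ℕ} (hm : m < b) (α : Column e) :
    S.fac m α = ∑ d, S.facCoeff m α d • X d :=
  eq_sum_of_isHomogeneous_one (S.fac_homogeneous m hm α)

lemma RollingSystem.eqn_eq_sum (S : RollingSystem e b p) {m : ℕ} (hm : m < b) :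
    S.eqn m = ∑ α, ∑ d, S.facCoeff m α d • (X d * X (topCoord α)) := by
  rw [S.eqn_eq m hm]
  refine Finset.sum_congr rfl fun α _ => ?_
  rw [S.fac_eq_sum hm, Finset.sum_mul]
  simp [zTop]

lemma RollingSystem.eqn_succ_eq_sum (S : RollingSystem e b p) {m : ℕ} (hm : m < b) :
    S.eqn (m + 1) = ∑ α, ∑ d, S.facCoeff m α d • (X d * X (botCoord α)) := by
  rw [S.eqn_succ m hm]
  refine Finset.sum_congr rfl fun α _ => ?_
  rw [S.fac_eq_sum hm, Finset.sum_mul]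
  simp [zBot]

lemma RollingSystem.quadForm_eqn (S : RollingSystem e b p) {m : ℕ} (hm : m < b)
    {Φ : Coord e → Coord e → A} (hΦ : ∀ c d, Φ c d = Φ d c) :
    quadForm K Φ (S.eqn m) = ∑ α, ∑ d, S.facCoeff m α d • Φ d (topCoord α) := by
  simp only [S.eqn_eq_sum hm, map_sum, map_smul, quadForm_X_mul_X hΦ]

lemma RollingSystem.quadForm_eqn_succ (S : RollingSystem e b p) {m : ℕ} (hm : m < b)
    {Φ : Coord e → Coord e → A} (hΦ : ∀ c d, Φ c d = Φ d c) :
    quadForm K Φ (S.eqn (m + 1)) = ∑ α, ∑ d, S.facCoeff m α d • Φ d (botCoord α) := by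
  simp only [S.eqn_succ_eq_sum hm, map_sum, map_smul, quadForm_X_mul_X hΦ]

lemma scrollForm_divisorEq {x y : Sym2 ι → ι} (hxy : ∀ I, s(x I, y I) = I)
    {Ψ : ι → ι → ℕ → A} (hΨ : ∀ i l N, Ψ i l N = Ψ l i N) (a m : ℕ) :
    scrollForm K Ψ (sVar ι K ^ a * tVar ι K ^ m * divisorEq e b p)
      = ∑ I, ∑ k ∈ coeffRange e b I, p I k • Ψ (x I) (y I) (k + m) := by
  simp only [divisorEq, Finset.mul_sum, map_sum]
  refine Finset.sum_congr rfl fun I _ => Finset.sum_congr rfl fun k _ => ?_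
  rw [fibreMonomial_eq K hxy, ← scrollForm_apply (K := K) hΨ (a + (deg e I - b - k)) (k + m), ← map_smul]
  congr 1
  rw [smul_eq_C_mul]
  ring

/-- A functional which depends only on the blocks and on `j + j'` for `z_{i,j} z_{i',j'}` factors
through the restriction to the scroll. -/
lemma RollingSystem.quadForm_eqn_of_scroll (S : RollingSystem e b p) {x y : Sym2 ι → ι}
    (hxy : ∀ I, s(x I, y I) = I) {m : ℕ} (hm : m < b) {Φ : Coord e → Coord e → A}
    {Ψ : ι → ι → ℕ → A} (hΨ : ∀ i l N, Ψ i l N = Ψ l i N)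
    (hΦ : ∀ c d : Coord e, Φ c d = Ψ c.1 d.1 (c.2 + d.2)) :
    quadForm K Φ (S.eqn m) = ∑ I, ∑ k ∈ coeffRange e b I, p I k • Ψ (x I) (y I) (k + m) := by
  have hsymm : ∀ c d, Φ c d = Φ d c := fun c d => by rw [hΦ, hΦ, hΨ, add_comm]
  rw [← scrollForm_divisorEq hxy hΨ (b - m) m, ← S.eqn_onScroll m hm.le, S.quadForm_eqn hm hsymm,
    S.eqn_eq_sum hm]
  simp only [map_sum, map_smul, map_mul]
  refine Finset.sum_congr rfl fun α _ => Finset.sum_congr rfl fun d _ => ?_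
  -- `scrollForm` ignores the power of `s`; the exponent is the one produced by `onScroll` on this
  -- monomial.
  rw [hΦ, ← scrollForm_apply (K := K) hΨ ((e d.1 - d.2) + (e α.1 - (α.2.castSucc : ℕ)))]
  congr 2
  simp only [onScroll, aeval_X]
  ring

end StandardDeformation

section Zeta

variable (K : Type*) [Field K] {ι : Type*} (e : ι → ℕ) (b : ℕ)

@[simp] lemma zeta_zero (i : ι) : zeta K e b i 0 = 0 := by simp [zeta]

lemma zeta_eq_zero {i : ι} {j : ℕ} (h : e i ≤ j) : zeta K e b i j = 0 :=
  dif_neg fun h' => by omega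

lemma rho_eq_zero {i : ι} {j : ℕ} (h : e i < j + b) : rho K e b i j = 0 :=
  dif_neg fun h' => by omega

end Zeta

lemma coord_eq_iff {ι : Type*} {e : ι → ℕ} {c d : Coord e} :
    c = d ↔ c.1 = d.1 ∧ (c.2 : ℕ) = d.2 := by
  obtain ⟨i, j⟩ := c
  obtain ⟨i', j'⟩ := d
  constructor
  · rintro ⟨⟩; simp
  · rintro ⟨rfl, h⟩
    have := Fin.ext h
    subst this; rfl

/-! ### The tails of a quadratic monomial -/

section TailForm

variable {K : Type*} [Field K] {ι : Type*} [DecidableEq ι] {e : ι → ℕ} {b : ℕ}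

variable (K e b) in
/-- Together with its transpose, the functional on `z_c z_d` which gives the coefficient of `z_{i,J}`
in the standard infinitesimal deformation, up to a pure rolling factors deformation. -/
def tailForm (i : ι) (J : ℕ) (c d : Coord e) : Params K e b :=
  if c.1 = i ∧ (c.2 : ℕ) ≤ J then zeta K e b d.1 (c.2 + d.2 - J) else 0

variable (K e b) in
/-- The symmetrization of `tailForm`. -/
def polarTail (i : ι) (J : ℕ) (c d : Coord e) : Params K e b :=
  tailForm K e b i J c d + tailForm K e b i J d c

lemma polarTail_comm (i : ι) (J : ℕ) (c d : Coord e) :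
    polarTail K e b i J c d = polarTail K e b i J d c := add_comm _ _

/-- The tail of the rolled factor moves with `J`. The tail of `z_d` keeps its `ζ`-index, but its
range gains the position `J + 1 = d.2`, where the value is `ζ_{α+1}` for the rolled column.
Truncated subtraction is harmless since `ζ_{i,0} = 0`. -/
lemma polarTail_botCoord (i : ι) (J : ℕ) (d : Coord e) (β : Column e) :
    polarTail K e b i (J + 1) d (botCoord β) = polarTail K e b i J d (topCoord β)
      + if d.1 = i ∧ (d.2 : ℕ) = J + 1 then zeta K e b β.1 (β.2 + 1) else 0 := by
  have h1 : ∀ u v : ℕ, u + (v + 1) - (J + 1) = u + v - J := fun u v => by omega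
  have h2 : ∀ u v : ℕ, u + 1 + v - (J + 1) = u + v - J := fun u v => by omega
  simp only [polarTail, tailForm, botCoord, topCoord, Fin.val_succ, Fin.val_castSucc, h1, h2,
    add_le_add_iff_right]
  by_cases h : d.1 = i
  · rcases lt_trichotomy (d.2 : ℕ) (J + 1) with h3 | h3 | h3
    · simp [h, h3.le, h3.ne, Nat.lt_succ_iff.1 h3]
    · simp only [h, h3, le_refl, and_self, if_true, true_and, Nat.not_succ_le_self, if_false,
        zero_add]
      rw [show J + 1 + (β.2 : ℕ) - J = β.2 + 1 by omega, add_comm]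
    · simp [h, h3.not_ge, h3.ne', show ¬ (d.2 : ℕ) ≤ J by omega]
  · simp [h]

lemma polarTail_zero_botCoord (i : ι) (d : Coord e) (β : Column e) :
    polarTail K e b i 0 d (botCoord β)
      = if d.1 = i ∧ (d.2 : ℕ) = 0 then zeta K e b β.1 (β.2 + 1) else 0 := by
  have h : ((d.2 : ℕ) = 0) ↔ d.2 = 0 := by rw [Fin.ext_iff]; rfl
  by_cases h1 : d.1 = i <;> by_cases h2 : d.2 = 0 <;> simp [polarTail, tailForm, h, h1, h2]

end TailForm

/-! ### Coefficients of the standard deformation and the lifting conditions -/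

section StandardDeformation

variable {K : Type*} [Field K] {ι : Type*} [Fintype ι] [DecidableEq ι] {e : ι → ℕ} {b : ℕ}
  {p : Sym2 ι → ℕ → K}

variable (K e b) in
/-- The terms of the standard deformation which do not depend on the choice of the `P_m`: they are
forced for `e i < k' + b`, and a pure rolling factors deformation otherwise. -/
def correction (p : Sym2 ι → ℕ → K) (x y : Sym2 ι → ι) (i : ι) (k' : ℕ) : Params K e b :=
  -∑ I, ∑ k ∈ coeffRange e b I, p I k •
    ((if i = x I ∧ e i ≤ k' + b then zeta K e b (y I) (k - k') else 0)
      + if i = y I then zeta K e b (x I) (k - k') else 0)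

/-- The coefficient of `z_d` in the `m`-th perturbation of the standard deformation. -/
def RollingSystem.stdCoeff (S : RollingSystem e b p) (x y : Sym2 ι → ι) (m : ℕ) (d : Coord e) :
    Params K e b :=
  quadForm K (polarTail K e b d.1 d.2) (S.eqn m)
    + if m ≤ (d.2 : ℕ) then correction K e b p x y d.1 (d.2 - m) else 0

/-- The coefficient of `z_d` in `∑ p_{α,m} ζ_{α+1}`. -/
def RollingSystem.shiftCoeff (S : RollingSystem e b p) (m : ℕ) (d : Coord e) : Params K e b :=
  ∑ α, S.facCoeff m α d • zeta K e b α.1 (α.2 + 1)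

lemma RollingSystem.shiftCoeff_eq (S : RollingSystem e b p) (m : ℕ) (i : ι) (j : Fin (e i + 1)) :
    S.shiftCoeff m ⟨i, j⟩ = ∑ α, ∑ d : Coord e, S.facCoeff m α d •
      if d.1 = i ∧ (d.2 : ℕ) = j then zeta K e b α.1 (α.2 + 1) else 0 := by
  refine Finset.sum_congr rfl fun α _ => ?_
  have h : ∀ d : Coord e, (d.1 = i ∧ (d.2 : ℕ) = j) ↔ d = ⟨i, j⟩ := fun d =>
    (coord_eq_iff (c := d) (d := ⟨i, j⟩)).symm
  simp only [h, smul_ite, smul_zero, Finset.sum_ite_eq', Finset.mem_univ, if_true]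

/-- `P_m` and `P_{m+1}` have the same factors `p_{α,m}`, so `polarTail_botCoord` applies term by
term; the correction depends only on the diagonal `j - m` and drops out. -/
lemma RollingSystem.stdCoeff_succ (S : RollingSystem e b p) (x y : Sym2 ι → ι) {m : ℕ} (hm : m < b)
    (α : Column e) :
    S.stdCoeff x y (m + 1) (botCoord α)
      = S.stdCoeff x y m (topCoord α) + S.shiftCoeff m (botCoord α) := by
  rw [S.shiftCoeff_eq, stdCoeff, stdCoeff, S.quadForm_eqn_succ hm (polarTail_comm _ _),
    S.quadForm_eqn hm (polarTail_comm _ _)]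
  simp only [Fin.val_succ, Fin.val_castSucc, polarTail_botCoord, smul_add, Finset.sum_add_distrib,
    Nat.add_sub_add_right, add_le_add_iff_right]
  ring

lemma RollingSystem.stdCoeff_succ_zero (S : RollingSystem e b p) (x y : Sym2 ι → ι) {m : ℕ}
    (hm : m < b) (i : ι) : S.stdCoeff x y (m + 1) ⟨i, 0⟩ = S.shiftCoeff m ⟨i, 0⟩ := by
  rw [S.shiftCoeff_eq, stdCoeff, S.quadForm_eqn_succ hm (polarTail_comm _ _)]
  simp [polarTail_zero_botCoord]

/-- A pair `I` containing `i` is `s(i, l)` for a unique `l`. It is met once on the left if `l ≠ i`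
and twice if `l = i`, which is the factor in the lifting conditions. -/
lemma sum_sym2_eq_sum {M : Type*} [AddCommGroup M] [Module K M] {x y : Sym2 ι → ι}
    (hxy : ∀ I, s(x I, y I) = I) (i : ι) (G : Sym2 ι → ι → M) :
    ∑ I, ((if x I = i then G I (y I) else 0) + if y I = i then G I (x I) else 0)
      = ∑ l, (if l = i then (2 : K) else 1) • G s(i, l) l := by
  have h : ∀ I, ((if x I = i then G I (y I) else 0) + if y I = i then G I (x I) else 0)
      = ∑ l, if s(i, l) = I then (if l = i then (2 : K) else 1) • G I l else 0 := by
    intro I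
    rw [← Finset.sum_filter]
    by_cases hx : x I = i
    · have hf : Finset.univ.filter (fun l => s(i, l) = I) = {y I} := by
        have hI : s(i, y I) = I := by rw [← hx, hxy]
        ext l
        rw [Finset.mem_filter, Finset.mem_singleton, ← Sym2.congr_right (a := i), hI]
        simp
      rw [hf, Finset.sum_singleton, if_pos hx]
      by_cases hy : y I = i
      · rw [if_pos hy, if_pos hy, two_smul, hx, hy]
      · rw [if_neg hy, if_neg hy, one_smul, add_zero]
    · rw [if_neg hx, zero_add]
      by_cases hy : y I = i
      · have hf : Finset.univ.filter (fun l => s(i, l) = I) = {x I} := by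
          have hI : s(i, x I) = I := by rw [← hy, Sym2.eq_swap, hxy]
          ext l
          rw [Finset.mem_filter, Finset.mem_singleton, ← Sym2.congr_right (a := i), hI]
          simp
        rw [hf, Finset.sum_singleton, if_pos hy, if_neg hx, one_smul]
      · rw [if_neg hy]
        refine (Finset.sum_eq_zero fun l hl => ?_).symm
        have hI := (Finset.mem_filter.1 hl).2
        rw [← hxy I, Sym2.eq_iff] at hI
        rcases hI with ⟨h1, -⟩ | ⟨h1, -⟩
        · exact absurd h1.symm hx
        · exact absurd h1.symm hy
  simp only [h]
  rw [Finset.sum_comm]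
  simp

lemma liftingForm_eq {x y : Sym2 ι → ι} (hxy : ∀ I, s(x I, y I) = I) (i : ι) (n : ℕ) :
    liftingForm e b p i n = ∑ I, ∑ k ∈ coeffRange e b I, p I k •
      ((if x I = i then zeta K e b (y I) (k + n) else 0)
        + if y I = i then zeta K e b (x I) (k + n) else 0) := by
  have h := sum_sym2_eq_sum (K := K) hxy i
    (fun I l => ∑ k ∈ coeffRange e b I, p I k • zeta K e b l (k + n))
  rw [liftingForm]
  calc _ = _ := Finset.sum_congr rfl fun l _ => ?_
    _ = _ := h.symm
    _ = _ := Finset.sum_congr rfl fun I _ => ?_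
  · rw [Finset.smul_sum]
    simp only [← smul_eq_C_mul, mul_smul]
  · simp only [smul_add, smul_ite, smul_zero, Finset.sum_add_distrib]
    congr 1 <;> split_ifs <;> simp

/-- At the last position no index of the block is cut off by the bound `J`, so the tail functional
factors through the scroll. For `m > e i` there is no correction and the lifting form remains; for
`m ≤ e i` the correction was chosen to cancel the value. -/
lemma RollingSystem.stdCoeff_last (S : RollingSystem e b p) {x y : Sym2 ι → ι}
    (hxy : ∀ I, s(x I, y I) = I) {m : ℕ} (hm : m < b) (i : ι) :
    S.stdCoeff x y m ⟨i, Fin.last _⟩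
      = if e i < m then liftingForm e b p i (m - e i) else 0 := by
  have hq := S.quadForm_eqn_of_scroll hxy hm (Φ := polarTail K e b i (e i))
    (Ψ := fun k l N => (if k = i then zeta K e b l (N - e i) else 0)
      + if l = i then zeta K e b k (N - e i) else 0) (fun k l N => add_comm _ _) (fun c d => by
        have h1 : ∀ d : Coord e, (d.1 = i ∧ (d.2 : ℕ) ≤ e i) ↔ d.1 = i := fun d =>
          ⟨fun h => h.1, fun h => ⟨h, by rw [← h]; omega⟩⟩
        simp only [polarTail, tailForm, h1]
        rw [add_comm (d.2 : ℕ) (c.2 : ℕ)])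
  rw [stdCoeff]
  simp only [Fin.val_last]
  rw [hq]
  rcases lt_or_ge (e i) m with h | h
  · rw [if_neg h.not_ge, if_pos h, add_zero, liftingForm_eq hxy]
    simp only [Nat.add_sub_assoc h.le]
  · rw [if_pos h, if_neg h.not_gt, correction, add_neg_eq_zero]
    refine Finset.sum_congr rfl fun I _ => Finset.sum_congr rfl fun k _ => ?_
    have h1 : k + m - e i = k - (e i - m) := by omega
    -- Since `m < b`, the case distinction in `correction` is not felt on diagonals that reach the
    -- last position before step `b`.
    have h2 : e i ≤ e i - m + b := by omega
    simp only [h1, h2, and_true, eq_comm (a := i)]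

end StandardDeformation

lemma sum_fin_eq_sum_range_of_eq_zero {M : Type*} [AddCommMonoid M] {n N : ℕ} (F : ℕ → M)
    (h1 : ∀ j, n ≤ j → F j = 0) (h2 : ∀ j, N < j → F j = 0) :
    ∑ j : Fin (n + 1), F j = ∑ j ∈ Finset.range (N + 1), F j := by
  rw [Fin.sum_univ_eq_sum_range,
    Finset.sum_subset (Finset.range_mono (le_max_left (n + 1) (N + 1))),
    ← Finset.sum_subset (Finset.range_mono (le_max_right (n + 1) (N + 1)))]
  · exact fun j _ hj => h2 j (by simpa [Nat.succ_le_iff] using hj)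
  · exact fun j _ hj => h1 j (by simp at hj; omega)

/-! ### A uniform expression for the terms of the base equations -/

section Term

variable (K : Type*) [Field K] {ι : Type*} (e : ι → ℕ) (b : ℕ)

/-- Every `l` is counted with weight `1 - [a ≤ l] - [l ≤ k]`, where `a = m + (e x - b)` with
truncated subtraction, so that cases I and II merge. If `a ≤ k` the two half-lines overlap in `[a,
k]`, with weight `-1`; otherwise they leave the gap `k < l < a`, with weight `1`. -/
lemma term_eq (x y : ι) (k : ℕ) {m : ℕ} (hm : 1 ≤ m) :
    term K e b x y k m = ∑ l ∈ Finset.range (k + m + 1),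
      (zeta K e b x l * zeta K e b y (k + m - l)
        - ((if m + (e x - b) ≤ l then zeta K e b x l * zeta K e b y (k + m - l) else 0)
          + if l ≤ k then zeta K e b x l * zeta K e b y (k + m - l) else 0)) := by
  have hIcc : ∀ u v : ℕ, v ≤ k + m → ∑ l ∈ Finset.Icc u v, zeta K e b y (k + m - l) * zeta K e b x l
      = ∑ l ∈ Finset.range (k + m + 1), if u ≤ l ∧ l ≤ v then
        zeta K e b x l * zeta K e b y (k + m - l) else 0 := by
    intro u v hv
    rw [← Finset.sum_filter]
    refine Finset.sum_congr ?_ fun _ _ => mul_comm _ _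
    ext l
    simp only [Finset.mem_Icc, Finset.mem_filter, Finset.mem_range]
    omega
  have hz : ∀ l, e x ≤ l ∨ l = 0 ∨ e y ≤ k + m - l ∨ k + m ≤ l →
      zeta K e b x l * zeta K e b y (k + m - l) = 0 := by
    rintro l (h | h | h | h)
    · rw [zeta_eq_zero K e b h, zero_mul]
    · rw [h, zeta_zero, zero_mul]
    · rw [zeta_eq_zero K e b h, mul_zero]
    · rw [Nat.sub_eq_zero_of_le h, zeta_zero, mul_zero]
  unfold term
  split_ifs with h1 h2 h2
  · rw [hIcc _ _ (by omega), ← Finset.sum_neg_distrib]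
    refine Finset.sum_congr rfl fun l _ => ?_
    split_ifs <;> first | omega | ring
  · rw [hIcc _ _ (by omega)]
    refine Finset.sum_congr rfl fun l _ => ?_
    -- Summands of the gap outside the bounds given by `max` and `min` have a vanishing `ζ` as a
    -- factor.
    split_ifs <;> first | omega | (rw [hz l (by omega)]; ring) | ring
  · rw [hIcc _ _ (by omega), ← Finset.sum_neg_distrib]
    refine Finset.sum_congr rfl fun l _ => ?_
    split_ifs <;> first | omega | ring
  · rw [hIcc _ _ (by omega)]
    refine Finset.sum_congr rfl fun l _ => ?_
    split_ifs <;> first | omega | (rw [hz l (by omega)]; ring) | ring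

end Term

/-! ### Substituting `ζ` for `z`: convolutions -/

section Convolution

variable (K : Type*) [Field K] {ι : Type*} [Fintype ι] [DecidableEq ι] (e : ι → ℕ) (b : ℕ)

lemma sum_coord_ite (i : ι) (F : ι → ℕ → Params K e b) :
    ∑ d : Coord e, (if d.1 = i then F d.1 d.2 else 0) = ∑ j : Fin (e i + 1), F i j := by
  rw [Fintype.sum_sigma, Finset.sum_eq_single i]
  · simp
  · intro k _ hk; simp [hk]
  · simp

lemma sum_tailForm_mul_zeta (c d : Coord e) :
    ∑ a : Coord e, tailForm K e b a.1 a.2 c d * zeta K e b a.1 a.2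
      = ∑ J ∈ Finset.range (c.2 + d.2 + 1), if (c.2 : ℕ) ≤ J then
          zeta K e b c.1 J * zeta K e b d.1 (c.2 + d.2 - J) else 0 := by
  rw [← sum_fin_eq_sum_range_of_eq_zero (n := e c.1) (fun J => if (c.2 : ℕ) ≤ J then
          zeta K e b c.1 J * zeta K e b d.1 (c.2 + d.2 - J) else 0),
    ← sum_coord_ite K e b c.1 (fun i J => if (c.2 : ℕ) ≤ J then
          zeta K e b i J * zeta K e b d.1 (c.2 + d.2 - J) else 0)]
  · refine Finset.sum_congr rfl fun a _ => ?_
    by_cases h1 : a.1 = c.1 <;> by_cases h2 : (c.2 : ℕ) ≤ a.2 <;>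
      simp [tailForm, h1, h2, eq_comm (a := c.1), mul_comm]
  · intro j hj; simp [zeta_eq_zero K e b hj]
  · intro j hj; simp [Nat.sub_eq_zero_of_le hj.le]

/-- After `J ↦ c.2 + d.2 - J` the second tail runs over `J ≤ c.2` and the first over `J ≥ c.2`; they
share only `J = c.2`. -/
lemma sum_polarTail_mul_zeta (c d : Coord e) :
    ∑ a : Coord e, polarTail K e b a.1 a.2 c d * zeta K e b a.1 a.2
      = ∑ J ∈ Finset.range (c.2 + d.2 + 1), zeta K e b c.1 J * zeta K e b d.1 (c.2 + d.2 - J)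
        + zeta K e b c.1 c.2 * zeta K e b d.1 d.2 := by
  have h1 := Finset.sum_flip (n := c.2 + d.2) (fun J => if (d.2 : ℕ) ≤ J then
    zeta K e b d.1 J * zeta K e b c.1 (c.2 + d.2 - J) else 0)
  have h2 : zeta K e b c.1 c.2 * zeta K e b d.1 d.2
      = ∑ J ∈ Finset.range (c.2 + d.2 + 1), if J = c.2 then
        zeta K e b c.1 J * zeta K e b d.1 (c.2 + d.2 - J) else 0 := by
    rw [Finset.sum_ite_eq', if_pos (by simp), Nat.add_sub_cancel_left]
  simp only [polarTail, add_mul, Finset.sum_add_distrib]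
  rw [sum_tailForm_mul_zeta, sum_tailForm_mul_zeta, add_comm (d.2 : ℕ), ← h1, h2,
    ← Finset.sum_add_distrib, ← Finset.sum_add_distrib]
  refine Finset.sum_congr rfl fun J hJ => ?_
  have hJ' := Finset.mem_range.1 hJ
  rw [Nat.sub_sub_self (by omega), mul_comm (zeta K e b d.1 _)]
  rcases lt_trichotomy J c.2 with h | h | h
  · rw [if_neg (by omega), if_pos (by omega), if_neg (by omega)]; ring
  · rw [if_pos (by omega), if_pos (by omega), if_pos (by omega)]
  · rw [if_pos (by omega), if_neg (by omega), if_neg (by omega)]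

/-- The contribution of the monomial `s ^ _ * t ^ k * z_x * z_y` of `P` to the corrections. -/
lemma sum_correctionTerm_mul_zeta (x y : ι) (k m : ℕ) :
    ∑ d : Coord e, (if m ≤ (d.2 : ℕ) then
        (if d.1 = x ∧ e d.1 ≤ d.2 - m + b then zeta K e b y (k - (d.2 - m)) else 0)
          + (if d.1 = y then zeta K e b x (k - (d.2 - m)) else 0) else 0) * zeta K e b d.1 d.2
      = ∑ l ∈ Finset.range (k + m + 1),
        ((if m + (e x - b) ≤ l then zeta K e b x l * zeta K e b y (k + m - l) else 0)
          + if l ≤ k then zeta K e b x l * zeta K e b y (k + m - l) else 0) := by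
  have h1 : ∀ d : Coord e, (if m ≤ (d.2 : ℕ) then
        (if d.1 = x ∧ e d.1 ≤ d.2 - m + b then zeta K e b y (k - (d.2 - m)) else 0)
          + (if d.1 = y then zeta K e b x (k - (d.2 - m)) else 0) else 0) * zeta K e b d.1 d.2
      = (if d.1 = x then if m + (e d.1 - b) ≤ (d.2 : ℕ) then
          zeta K e b d.1 d.2 * zeta K e b y (k + m - d.2) else 0 else 0)
        + if d.1 = y then if m ≤ (d.2 : ℕ) then
          zeta K e b d.1 d.2 * zeta K e b x (k + m - d.2) else 0 else 0 := by
    intro d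
    by_cases hm : m ≤ (d.2 : ℕ)
    · have h2 : k - ((d.2 : ℕ) - m) = k + m - d.2 := by omega
      have h3 : e d.1 ≤ d.2 - m + b ↔ m + (e d.1 - b) ≤ (d.2 : ℕ) := by omega
      simp only [hm, if_true, h2, h3, ite_and, add_mul, ite_mul, zero_mul,
        mul_comm (zeta K e b d.1 d.2)]
    · have h2 : ¬ m + (e d.1 - b) ≤ (d.2 : ℕ) := by omega
      simp [hm, h2]
  have h4 := Finset.sum_flip (n := k + m) (fun l => if m ≤ l then
    zeta K e b y l * zeta K e b x (k + m - l) else 0)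
  rw [Finset.sum_congr rfl fun d _ => h1 d, Finset.sum_add_distrib,
    sum_coord_ite K e b x fun i j => if m + (e i - b) ≤ j then
          zeta K e b i j * zeta K e b y (k + m - j) else 0,
    sum_coord_ite K e b y fun i j => if m ≤ j then
          zeta K e b i j * zeta K e b x (k + m - j) else 0,
    sum_fin_eq_sum_range_of_eq_zero (N := k + m) (fun j => if m + (e x - b) ≤ j then
          zeta K e b x j * zeta K e b y (k + m - j) else 0),
    sum_fin_eq_sum_range_of_eq_zero (N := k + m) (fun j => if m ≤ j then
          zeta K e b y j * zeta K e b x (k + m - j) else 0),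
    ← h4, Finset.sum_add_distrib]
  · congr 1
    refine Finset.sum_congr rfl fun l hl => ?_
    have hl' := Finset.mem_range.1 hl
    have h5 : m ≤ k + m - l ↔ l ≤ k := by omega
    rw [Nat.sub_sub_self (by omega), mul_comm]
    simp only [h5]
  · intro j hj; simp [zeta_eq_zero K e b hj]
  · intro j hj; simp [Nat.sub_eq_zero_of_le hj.le]
  · intro j hj; simp [zeta_eq_zero K e b hj]
  · intro j hj; simp [Nat.sub_eq_zero_of_le hj.le]

end Convolution

section StandardDeformation

variable {K : Type*} [Field K] {ι : Type*} [Fintype ι] [DecidableEq ι] {e : ι → ℕ} {b : ℕ}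
  {p : Sym2 ι → ℕ → K}

lemma sum_correction_mul_zeta (x y : Sym2 ι → ι) (m : ℕ) :
    ∑ d : Coord e, (if m ≤ (d.2 : ℕ) then correction K e b p x y d.1 (d.2 - m) else 0)
        * zeta K e b d.1 d.2
      = -∑ I, ∑ k ∈ coeffRange e b I, p I k • ∑ l ∈ Finset.range (k + m + 1),
        ((if m + (e (x I) - b) ≤ l then
            zeta K e b (x I) l * zeta K e b (y I) (k + m - l) else 0)
          + if l ≤ k then zeta K e b (x I) l * zeta K e b (y I) (k + m - l) else 0) := by
  simp only [← sum_correctionTerm_mul_zeta, Finset.smul_sum]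
  rw [← Finset.sum_neg_distrib]
  simp only [← Finset.sum_neg_distrib]
  rw [Finset.sum_congr rfl fun I _ => Finset.sum_comm, Finset.sum_comm]
  refine Finset.sum_congr rfl fun d _ => ?_
  by_cases hm : m ≤ (d.2 : ℕ)
  · simp only [hm, if_true, correction, ← Finset.sum_neg_distrib, Finset.sum_mul, neg_mul,
      smul_mul_assoc]
  · simp [hm]

/-- The base equations of the standard deformation, without the parameters `ρ`. -/
lemma RollingSystem.sum_stdCoeff_mul_zeta (S : RollingSystem e b p) {x y : Sym2 ι → ι}
    (hxy : ∀ I, s(x I, y I) = I) {m : ℕ} (hm : 1 ≤ m) (hmb : m < b) :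
    ∑ d : Coord e, S.stdCoeff x y m d * zeta K e b d.1 d.2
        - aeval (fun d : Coord e => zeta K e b d.1 (d.2 : ℕ)) (S.eqn m)
      = ∑ I, ∑ k ∈ coeffRange e b I, C (p I k) * term K e b (x I) (y I) k m := by
  -- Subtracting the monomial of `P_m(ζ)` removes the doubled summand, leaving a functional that
  -- sees only the two blocks and the sum of the indices.
  have h1 := S.quadForm_eqn_of_scroll hxy hmb
    (Φ := fun c d => ∑ a : Coord e, polarTail K e b a.1 a.2 c d * zeta K e b a.1 a.2
      - zeta K e b c.1 c.2 * zeta K e b d.1 d.2)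
    (Ψ := fun i l N => ∑ J ∈ Finset.range (N + 1), zeta K e b i J * zeta K e b l (N - J))
    (fun i l N => by
      rw [← Finset.sum_flip]
      refine Finset.sum_congr rfl fun J hJ => ?_
      rw [Nat.sub_sub_self (Nat.lt_succ_iff.1 (Finset.mem_range.1 hJ)), mul_comm])
    (fun c d => by rw [sum_polarTail_mul_zeta, add_sub_cancel_right])
  have h2 : quadForm K (fun c d : Coord e =>
      ∑ a : Coord e, polarTail K e b a.1 a.2 c d * zeta K e b a.1 a.2
        - zeta K e b c.1 c.2 * zeta K e b d.1 d.2) (S.eqn m)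
      = ∑ d : Coord e, quadForm K (polarTail K e b d.1 d.2) (S.eqn m) * zeta K e b d.1 d.2
        - aeval (fun d : Coord e => zeta K e b d.1 (d.2 : ℕ)) (S.eqn m) := by
    simp only [S.quadForm_eqn hmb (polarTail_comm _ _)]
    rw [S.quadForm_eqn hmb fun c d => by
      simp only [polarTail_comm _ _ c d, mul_comm (zeta K e b c.1 _)], S.eqn_eq_sum hmb]
    simp only [map_sum, map_smul, map_mul, aeval_X, smul_sub, Finset.sum_sub_distrib,
      Finset.sum_mul, Finset.smul_sum, smul_mul_assoc]
    congr 1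
    rw [Finset.sum_congr rfl fun α _ => Finset.sum_comm, Finset.sum_comm]
  simp only [stdCoeff, add_mul, Finset.sum_add_distrib]
  rw [sum_correction_mul_zeta, add_sub_right_comm, ← h2, h1, ← sub_eq_add_neg,
    ← Finset.sum_sub_distrib]
  refine Finset.sum_congr rfl fun I _ => ?_
  rw [← Finset.sum_sub_distrib]
  refine Finset.sum_congr rfl fun k _ => ?_
  rw [term_eq K e b _ _ _ hm, ← smul_eq_C_mul, ← smul_sub, Finset.sum_sub_distrib]

end StandardDeformation

/-! ### Existence of additional equations -/

section Existence

variable {K : Type*} [CommRing K] {ι : Type*} (e : ι → ℕ) (b : ℕ)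

variable (K) in
/-- The coordinate `z_{i,j}`, which is `0` unless `j ≤ e i`. -/
def zCoord (i : ι) (j : ℕ) : MvPolynomial (Coord e) K :=
  if h : j ≤ e i then X ⟨i, ⟨j, by omega⟩⟩ else 0

lemma zCoord_isHomogeneous (i : ι) (j : ℕ) : (zCoord K e i j).IsHomogeneous 1 := by
  unfold zCoord
  split_ifs
  · exact isHomogeneous_X _ _
  · exact isHomogeneous_zero _ _ _

lemma onScroll_zCoord {i : ι} {j : ℕ} (h : j ≤ e i) :
    onScroll K e (zCoord K e i j) = sVar ι K ^ (e i - j) * tVar ι K ^ j * X (Sum.inr i) := by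
  simp [zCoord, h, onScroll]

variable [Fintype ι] [DecidableEq ι]

lemma sum_ite_mul_zTop {i : ι} {j : ℕ} (h : j < e i) (f : MvPolynomial (Coord e) K) :
    ∑ α : Column e, (if α.1 = i ∧ (α.2 : ℕ) = j then f else 0) * zTop K e α
      = f * zCoord K e i j := by
  rw [Finset.sum_eq_single (⟨i, ⟨j, h⟩⟩ : Column e)]
  · simp [zTop, zCoord, h.le, Fin.castSucc]
  · rintro ⟨i', j'⟩ - hne
    rw [if_neg, zero_mul]
    rintro ⟨h1, h2⟩
    dsimp only at h1 h2
    subst h1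
    subst h2
    exact hne rfl
  · simp

lemma sum_ite_mul_zBot {i : ι} {j : ℕ} (h : j < e i) (f : MvPolynomial (Coord e) K) :
    ∑ α : Column e, (if α.1 = i ∧ (α.2 : ℕ) = j then f else 0) * zBot K e α
      = f * zCoord K e i (j + 1) := by
  rw [Finset.sum_eq_single (⟨i, ⟨j, h⟩⟩ : Column e)]
  · simp [zBot, zCoord, Nat.succ_le_iff.2 h, Fin.succ]
  · rintro ⟨i', j'⟩ - hne
    rw [if_neg, zero_mul]
    rintro ⟨h1, h2⟩
    dsimp only at h1 h2
    subst h1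
    subst h2
    exact hne rfl
  · simp

/-- The factor of the monomial `z_{x,min N (e x)} z_{y,N - e x}` which is not rolled. -/
def pathFactor (x y : ι) (N : ℕ) (α : Column e) : MvPolynomial (Coord e) K :=
  if N < e x then if α.1 = x ∧ (α.2 : ℕ) = N then zCoord K e y 0 else 0
  else if α.1 = y ∧ (α.2 : ℕ) = N - e x then zCoord K e x (e x) else 0

lemma sum_pathFactor_mul_zTop {x y : ι} {N : ℕ} (h : N < e x + e y) :
    ∑ α, pathFactor (K := K) e x y N α * zTop K e α
      = zCoord K e x (min N (e x)) * zCoord K e y (N - e x) := by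
  unfold pathFactor
  split_ifs with h1
  · rw [sum_ite_mul_zTop e h1, min_eq_left h1.le, Nat.sub_eq_zero_of_le h1.le, mul_comm]
  · rw [sum_ite_mul_zTop e (by omega), min_eq_right (not_lt.1 h1)]

lemma sum_pathFactor_mul_zBot {x y : ι} {N : ℕ} (h : N < e x + e y) :
    ∑ α, pathFactor (K := K) e x y N α * zBot K e α
      = zCoord K e x (min (N + 1) (e x)) * zCoord K e y (N + 1 - e x) := by
  unfold pathFactor
  split_ifs with h1
  · rw [sum_ite_mul_zBot e h1, min_eq_left h1, Nat.sub_eq_zero_of_le h1, mul_comm]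
  · rw [sum_ite_mul_zBot e (by omega), min_eq_right (by omega), Nat.sub_add_comm (not_lt.1 h1)]

end Existence

section Existence

variable {K : Type*} [Field K] {ι : Type*} [Fintype ι] [DecidableEq ι] (e : ι → ℕ) (b : ℕ)

/-- Additional equations in which first the factor `z_x` and then the factor `z_y` of each monomial
is rolled. -/
def pathSystem (p : Sym2 ι → ℕ → K) (x y : Sym2 ι → ι) (hxy : ∀ I, s(x I, y I) = I) :
    RollingSystem e b p where
  eqn m := ∑ I, ∑ k ∈ coeffRange e b I, C (p I k) *
    (zCoord K e (x I) (min (k + m) (e (x I))) * zCoord K e (y I) (k + m - e (x I)))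
  fac m α := ∑ I, ∑ k ∈ coeffRange e b I, C (p I k) * pathFactor e (x I) (y I) (k + m) α
  eqn_homogeneous m _ := by
    refine IsHomogeneous.sum _ _ _ fun I _ => IsHomogeneous.sum _ _ _ fun k _ => ?_
    exact (isHomogeneous_C _ _).mul ((zCoord_isHomogeneous e _ _).mul (zCoord_isHomogeneous e _ _))
  eqn_onScroll m hm := by
    simp only [divisorEq, map_sum, map_mul, Finset.mul_sum]
    refine Finset.sum_congr rfl fun I _ => Finset.sum_congr rfl fun k hk => ?_
    have hdeg := deg_eq e hxy I
    have hmon := fibreMonomial_eq K hxy I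
    have hk' := Finset.mem_range.1 hk
    rw [hdeg] at hk'
    rw [onScroll_zCoord e (min_le_right _ _), onScroll_zCoord e (by omega), hmon, hdeg]
    have h1 : onScroll K e (C (p I k)) = C (p I k) := by
      rw [onScroll, aeval_C]; rfl
    have hs : sVar ι K ^ (e (x I) - min (k + m) (e (x I))) * sVar ι K ^ (e (y I) - (k + m - e (x I)))
        = sVar ι K ^ (b - m) * sVar ι K ^ (e (x I) + e (y I) - b - k) := by
      rw [← pow_add, ← pow_add]; congr 1; omega
    have ht : tVar ι K ^ (min (k + m) (e (x I))) * tVar ι K ^ (k + m - e (x I))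
        = tVar ι K ^ m * tVar ι K ^ k := by
      rw [← pow_add, ← pow_add]; congr 1; omega
    rw [h1]
    linear_combination C (p I k) * X (Sum.inr (x I)) * X (Sum.inr (y I)) *
      (tVar ι K ^ (min (k + m) (e (x I))) * tVar ι K ^ (k + m - e (x I)) * hs
        + sVar ι K ^ (b - m) * sVar ι K ^ (e (x I) + e (y I) - b - k) * ht)
  fac_homogeneous m _ α := by
    refine IsHomogeneous.sum _ _ _ fun I _ => IsHomogeneous.sum _ _ _ fun k _ => ?_
    refine (zero_add 1) ▸ (isHomogeneous_C _ _).mul (?_ : (pathFactor e _ _ _ _).IsHomogeneous 1)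
    unfold pathFactor
    split_ifs <;> first | exact zCoord_isHomogeneous e _ _ | exact isHomogeneous_zero _ _ _
  eqn_eq m hm := by
    simp only [Finset.sum_mul]
    rw [Finset.sum_comm]
    refine Finset.sum_congr rfl fun I _ => ?_
    rw [Finset.sum_comm]
    refine Finset.sum_congr rfl fun k hk => ?_
    have hdeg := deg_eq e hxy I
    have hk' := Finset.mem_range.1 hk
    simp only [mul_assoc]
    rw [← Finset.mul_sum, sum_pathFactor_mul_zTop e (by omega)]
  eqn_succ m hm := by
    simp only [Finset.sum_mul]
    rw [Finset.sum_comm]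
    refine Finset.sum_congr rfl fun I _ => ?_
    rw [Finset.sum_comm]
    refine Finset.sum_congr rfl fun k hk => ?_
    have hdeg := deg_eq e hxy I
    have hk' := Finset.mem_range.1 hk
    simp only [mul_assoc]
    rw [← Finset.mul_sum, sum_pathFactor_mul_zBot e (by omega), ← add_assoc]

end Existence

/-! ### Linear relations on the scroll -/

section LinearForms

variable {ι A : Type*} [CommRing A] {e : ι → ℕ}

/-- The condition, modulo `J`, that `s ∑ H_d z_d = t ∑ F_d z_d` on the scroll. -/
structure IsLift (J : Ideal A) (F H : Coord e → A) : Prop where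
  first : ∀ i, H ⟨i, 0⟩ ∈ J
  column : ∀ α : Column e, H (botCoord α) - F (topCoord α) ∈ J
  last : ∀ i, F ⟨i, Fin.last _⟩ ∈ J

/-- The coefficient of `z_i` in the restriction of `∑ F_d z_d` to the scroll, for `s = 1`. -/
def blockPoly (F : Coord e → A) (i : ι) : Polynomial A :=
  ∑ j : Fin (e i + 1), Polynomial.C (F ⟨i, j⟩) * Polynomial.X ^ (j : ℕ)

lemma coeff_blockPoly (F : Coord e → A) (i : ι) (N : ℕ) :
    (blockPoly F i).coeff N = if h : N < e i + 1 then F ⟨i, ⟨N, h⟩⟩ else 0 := by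
  simp only [blockPoly, Polynomial.finsetSum_coeff, Polynomial.coeff_C_mul_X_pow]
  split_ifs with h
  · rw [Finset.sum_eq_single ⟨N, h⟩]
    · simp
    · intro j _ hj
      rw [if_neg fun h' => hj (Fin.ext h'.symm)]
    · simp
  · exact Finset.sum_eq_zero fun j _ => if_neg (by omega)

lemma isLift_of_blockPoly_mem {J : Ideal A} {F H : Coord e → A}
    (h : ∀ i, blockPoly H i - Polynomial.X * blockPoly F i ∈ J.map Polynomial.C) :
    IsLift J F H := by
  simp only [Ideal.mem_map_C_iff] at h
  refine ⟨fun i => ?_, fun α => ?_, fun i => ?_⟩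
  · simpa [coeff_blockPoly] using h i 0
  · have h1 := h α.1 (α.2 + 1)
    rw [Polynomial.coeff_sub, Polynomial.coeff_X_mul, coeff_blockPoly, coeff_blockPoly,
      dif_pos (by omega), dif_pos (by omega)] at h1
    exact h1
  · have h1 := h i (e i + 1)
    rw [Polynomial.coeff_sub, Polynomial.coeff_X_mul, coeff_blockPoly, coeff_blockPoly,
      dif_neg (by omega), dif_pos (by omega), zero_sub, J.neg_mem_iff] at h1
    exact h1

variable [Fintype ι]

lemma mem_of_sum_C_mul_X_add_C_mem {R : Type*} [CommRing R] {I : Ideal R} {q : ι → R} {q₀ : R}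
    (h : ∑ i, C (q i) * X i + C q₀ ∈ I.map (C : R →+* MvPolynomial ι R)) :
    (∀ i, q i ∈ I) ∧ q₀ ∈ I := by
  classical
  rw [mem_map_C_iff] at h
  refine ⟨fun i => ?_, ?_⟩
  · have h1 := h (Finsupp.single i 1)
    have h2 : (0 : ι →₀ ℕ) ≠ Finsupp.single i 1 := by
      simp [eq_comm (a := (0 : ι →₀ ℕ))]
    simpa [coeff_sum, coeff_C_mul, coeff_X, coeff_C, h2, Finsupp.single_left_inj] using h1
  · simpa [coeff_sum, coeff_C_mul] using h 0

lemma onScroll_sum (F : Coord e → A) :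
    onScroll A e (∑ d, C (F d) * X d) = ∑ i, ∑ j : Fin (e i + 1),
      C (F ⟨i, j⟩) * (sVar ι A ^ (e i - j) * tVar ι A ^ (j : ℕ) * X (Sum.inr i)) := by
  simp only [map_sum, map_mul, onScroll, aeval_X, Fintype.sum_sigma, aeval_C]
  rfl

lemma mem_iff_isLift {J : Ideal A} {F H : Coord e → A} :
    sVar ι A * onScroll A e (∑ d, C (H d) * X d) - tVar ι A * onScroll A e (∑ d, C (F d) * X d)
      ∈ J.map (C : A →+* Cox ι A) ↔ IsLift J F H := by
  constructor
  · intro h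
    -- Dehomogenization at `s = 1`, with `t` moved into the coefficients: the block of `z_i` becomes
    -- a polynomial in `t` and can be read off coefficientwise.
    let θ : Cox ι A →ₐ[A] MvPolynomial ι (Polynomial A) :=
      aeval (Sum.elim ![1, C Polynomial.X] X)
    have hθ : ∀ F : Coord e → A,
        θ (onScroll A e (∑ d, C (F d) * X d)) = ∑ i, C (blockPoly F i) * X i := by
      intro F
      rw [onScroll_sum]
      simp only [map_sum, map_mul, map_pow, blockPoly, Finset.sum_mul]
      refine Finset.sum_congr rfl fun i _ => Finset.sum_congr rfl fun j _ => ?_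
      simp only [θ, sVar, tVar, aeval_X, aeval_C, Sum.elim_inl, Sum.elim_inr]
      simp only [Matrix.cons_val_zero, Matrix.cons_val_one, one_pow, one_mul]
      rw [mul_assoc]
      rfl
    have h1 := Ideal.mem_map_of_mem θ.toRingHom h
    rw [Ideal.map_map] at h1
    have h2 : θ.toRingHom.comp C = (C : _ →+* MvPolynomial ι (Polynomial A)).comp Polynomial.C := by
      ext a
      simp only [θ, RingHom.comp_apply, AlgHom.toRingHom_eq_coe, RingHom.coe_coe, aeval_C]
      rfl
    rw [h2, ← Ideal.map_map] at h1
    apply isLift_of_blockPoly_mem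
    refine (mem_of_sum_C_mul_X_add_C_mem (q₀ := 0) ?_).1
    convert h1 using 1
    have h3 : θ (sVar ι A) = 1 := by simp [θ, sVar]
    have h4 : θ (tVar ι A) = C Polynomial.X := by simp [θ, tVar]
    simp only [AlgHom.toRingHom_eq_coe, RingHom.coe_coe, map_sub, map_mul, hθ, h3, h4, one_mul,
      map_zero, add_zero, Finset.mul_sum, ← Finset.sum_sub_distrib]
    exact Finset.sum_congr rfl fun i _ => by ring
  · intro h
    have hC : ∀ {a : A}, a ∈ J → ∀ q : Cox ι A, C a * q ∈ J.map (C : A →+* Cox ι A) :=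
      fun ha q => Ideal.mul_mem_right _ _ (Ideal.mem_map_of_mem _ ha)
    simp only [onScroll_sum, Finset.mul_sum]
    rw [← Finset.sum_sub_distrib]
    refine Ideal.sum_mem _ fun i _ => ?_
    have key : ∑ j : Fin (e i + 1), sVar ι A * (C (H ⟨i, j⟩) *
          (sVar ι A ^ (e i - j) * tVar ι A ^ (j : ℕ) * X (Sum.inr i)))
        - ∑ j : Fin (e i + 1), tVar ι A * (C (F ⟨i, j⟩) *
          (sVar ι A ^ (e i - j) * tVar ι A ^ (j : ℕ) * X (Sum.inr i)))
        = C (H ⟨i, 0⟩) * (sVar ι A ^ (e i + 1) * X (Sum.inr i))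
          + ∑ j : Fin (e i), C (H ⟨i, j.succ⟩ - F ⟨i, j.castSucc⟩) *
            (sVar ι A ^ (e i - j) * tVar ι A ^ (j + 1 : ℕ) * X (Sum.inr i))
          - C (F ⟨i, Fin.last _⟩) * (tVar ι A ^ (e i + 1) * X (Sum.inr i)) := by
      have h0 : ∀ a b c d : Cox ι A, a + b - (c + d) = a + (b - c) - d := fun _ _ _ _ => by ring
      rw [Fin.sum_univ_succ, Fin.sum_univ_castSucc, h0, ← Finset.sum_sub_distrib]
      have h1 : ∀ j : Fin (e i), sVar ι A * (C (H ⟨i, j.succ⟩) *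
          (sVar ι A ^ (e i - j.succ) * tVar ι A ^ (j.succ : ℕ) * X (Sum.inr i)))
          - tVar ι A * (C (F ⟨i, j.castSucc⟩) *
          (sVar ι A ^ (e i - j.castSucc) * tVar ι A ^ (j.castSucc : ℕ) * X (Sum.inr i)))
          = C (H ⟨i, j.succ⟩ - F ⟨i, j.castSucc⟩) *
            (sVar ι A ^ (e i - j) * tVar ι A ^ (j + 1 : ℕ) * X (Sum.inr i)) := by
        intro j
        have h2 : e i - (j : ℕ) = e i - (j + 1) + 1 := by omega
        simp only [Fin.val_succ, Fin.val_castSucc, h2, map_sub]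
        ring
      simp only [h1, Fin.val_last, Fin.val_zero]
      simp only [Nat.sub_zero, Nat.sub_self]
      ring
    rw [key]
    exact Ideal.sub_mem _ (Ideal.add_mem _ (hC (h.first i) _)
      (Ideal.sum_mem _ fun j _ => hC (h.column ⟨i, j⟩) _)) (hC (h.last i) _)

end LinearForms

/-- Passes from a sum over the coordinates of a block to one over its diagonals `j - m`; it is used
both for the `ρ` and for the forms `τ`. -/
lemma sum_shift_mul {M : Type*} [CommSemiring M] {n b : ℕ} (m : ℕ) (r g : ℕ → M)
    (hr : ∀ j, n < j + b → r j = 0) (hg : ∀ j, n < j → g j = 0) :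
    ∑ j : Fin (n + 1), (if m ≤ (j : ℕ) then r (j - m) else 0) * g j
      = ∑ j ∈ Finset.range (n + 1 - b), r j * g (j + m) := by
  rw [Fin.sum_univ_eq_sum_range (fun j => (if m ≤ j then r (j - m) else 0) * g j)]
  have h2 := Finset.sum_range_add (fun j => (if m ≤ j then r (j - m) else 0) * g j) m (n + 1)
  rw [Finset.sum_eq_zero (s := Finset.range m) (fun j hj => by
    rw [if_neg (by simpa using hj), zero_mul]), zero_add] at h2
  rw [Finset.sum_subset (Finset.range_mono (Nat.le_add_left (n + 1) m)), h2]
  · rw [← Finset.sum_subset (Finset.range_mono (Nat.sub_le (n + 1) b))]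
    · exact Finset.sum_congr rfl fun j _ => by simp [add_comm m j]
    · intro j _ hj
      rw [Finset.mem_range] at hj
      simp [hr j (by omega)]
  · intro j _ hj
    rw [Finset.mem_range] at hj
    rw [hg j (by omega), mul_zero]

/-! ### Coefficients of the perturbations -/

section PureCoeff

variable {K : Type*} [Field K] {ι : Type*} {e : ι → ℕ} {b : ℕ}

variable (K e b) in
/-- The coefficient of `z_d` in the pure rolling factors part of `P'_m`. -/
def pureCoeff (m : ℕ) (d : Coord e) : Params K e b :=
  if m ≤ (d.2 : ℕ) then rho K e b d.1 (d.2 - m) else 0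

lemma pureCoeff_succ_botCoord (m : ℕ) (α : Column e) :
    pureCoeff K e b (m + 1) (botCoord α) = pureCoeff K e b m (topCoord α) := by
  simp [pureCoeff]

lemma pureCoeff_succ_zero (m : ℕ) (i : ι) : pureCoeff K e b (m + 1) ⟨i, 0⟩ = 0 := by
  simp [pureCoeff]

lemma pureCoeff_last {m : ℕ} (hm : m < b) (i : ι) : pureCoeff K e b m ⟨i, Fin.last _⟩ = 0 := by
  unfold pureCoeff
  split_ifs with h
  · simp only [Fin.val_last] at h ⊢
    exact rho_eq_zero K e b (by omega)
  · rfl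

variable [Fintype ι]

/-- The coefficient of `z_d` in `P'_m`. -/
def pertCoeff (c : ℕ → Coord e → ScrollParam e → K) (m : ℕ) (d : Coord e) : Params K e b :=
  linForm e b (c m d) + pureCoeff K e b m d

lemma perturbation_eq (c : ℕ → Coord e → ScrollParam e → K) (m : ℕ) :
    perturbation e b c m = ∑ d, C (pertCoeff c m d) * X d := by
  simp only [perturbation, pertCoeff, map_add, add_mul, Finset.sum_add_distrib]
  congr 1
  rw [Fintype.sum_sigma]
  refine Finset.sum_congr rfl fun i _ => ?_
  have h := sum_shift_mul (n := e i) (b := b) m (fun j => C (rho K e b i j))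
    (zCoord (Params K e b) e i) (fun j hj => by simp [rho_eq_zero K e b hj])
    fun j hj => by simp [zCoord, hj.not_ge]
  calc _ = _ := ?_
    _ = _ := h.symm
    _ = _ := ?_
  · refine Finset.sum_congr rfl fun j _ => ?_
    by_cases hj : j + m ≤ e i <;> simp [zCoord, hj]
  · refine Finset.sum_congr rfl fun j _ => ?_
    rw [zCoord, dif_pos (Nat.lt_succ_iff.1 j.2), pureCoeff]
    split_ifs <;> simp

end PureCoeff

section Perturbation

variable {K : Type*} [Field K] {ι : Type*} [Fintype ι] [DecidableEq ι] {e : ι → ℕ} {b : ℕ}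
  {p : Sym2 ι → ℕ → K}

lemma RollingSystem.sum_fac_mul_zeta (S : RollingSystem e b p) {m : ℕ} (hm : m < b) :
    ∑ α, map C (S.fac m α) * C (zeta K e b α.1 ((α.2 : ℕ) + 1))
      = ∑ d, C (S.shiftCoeff m d) * X d := by
  simp only [shiftCoeff, map_sum, Finset.sum_mul]
  rw [Finset.sum_comm]
  refine Finset.sum_congr rfl fun α _ => ?_
  rw [S.fac_eq_sum hm]
  simp only [smul_eq_C_mul, map_sum, map_mul, map_C, map_X, Finset.sum_mul]
  exact Finset.sum_congr rfl fun d _ => by ring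

/-- The defining condition of an infinitesimal deformation, on coefficients. -/
lemma RollingSystem.lifts_iff (S : RollingSystem e b p) (c : ℕ → Coord e → ScrollParam e → K)
    {m : ℕ} (hm : m < b) :
    sVar ι (Params K e b) * onScroll (Params K e b) e (perturbation e b c (m + 1))
      - tVar ι (Params K e b) * onScroll (Params K e b) e (perturbation e b c m)
      - sVar ι (Params K e b) * onScroll (Params K e b) e
          (∑ α, map C (S.fac m α) * C (zeta K e b α.1 ((α.2 : ℕ) + 1)))
      ∈ (liftingIdeal e b p).map (C : Params K e b →+* Cox ι (Params K e b)) ↔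
    IsLift (liftingIdeal e b p) (pertCoeff c m) fun d => pertCoeff c (m + 1) d - S.shiftCoeff m d := by
  rw [← mem_iff_isLift, perturbation_eq, perturbation_eq, S.sum_fac_mul_zeta hm]
  simp only [map_sub, sub_mul, Finset.sum_sub_distrib, mul_sub]
  rw [sub_right_comm]

end Perturbation

/-! ### The standard deformation -/

section LinearFormsInZeta

variable (K : Type*) [Field K] {ι : Type*} (e : ι → ℕ) (b : ℕ)

/-- The space of `K`-linear forms in the `ζ_{i,j}`. -/
def zetaForms : Submodule K (Params K e b) :=
  Submodule.span K (Set.range fun a => X (Sum.inl a))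

variable {K e b}

lemma zeta_mem_zetaForms (i : ι) (j : ℕ) : zeta K e b i j ∈ zetaForms K e b := by
  unfold zeta
  split_ifs
  · exact Submodule.subset_span ⟨_, rfl⟩
  · exact zero_mem _

variable [Fintype ι]

lemma mem_zetaForms {q : Params K e b} : q ∈ zetaForms K e b ↔ ∃ c, linForm e b c = q := by
  simp only [zetaForms, Submodule.mem_span_range_iff_exists_fun, linForm, smul_eq_C_mul]

lemma linForm_sub (c c' : ScrollParam e → K) :
    linForm e b (c - c') = linForm e b c - linForm e b c' := by
  simp [linForm, sub_mul, Finset.sum_sub_distrib]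

lemma linForm_zero : linForm e b (0 : ScrollParam e → K) = 0 := by
  simp [linForm]

end LinearFormsInZeta

lemma quadForm_mem {σ K A : Type*} [CommRing K] [AddCommGroup A] [Module K A] {Φ : σ → σ → A}
    {M : Submodule K A} (hΦ : ∀ c d, Φ c d ∈ M) (q : MvPolynomial σ K) : quadForm K Φ q ∈ M := by
  have h1 : ∀ s, quadValue Φ s ∈ M := fun s => by
    unfold quadValue
    split_ifs
    · exact hΦ _ _
    · exact zero_mem _
  have h2 : LinearMap.range (quadForm K Φ) ≤ M := by
    rw [quadForm, Module.Basis.constr_range, Submodule.span_le]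
    rintro _ ⟨s, rfl⟩
    exact h1 s
  exact h2 ⟨q, rfl⟩

section StandardDeformation

variable {K : Type*} [Field K] {ι : Type*} [Fintype ι] [DecidableEq ι] {e : ι → ℕ} {b : ℕ}
  {p : Sym2 ι → ℕ → K}

lemma correction_mem_zetaForms (x y : Sym2 ι → ι) (i : ι) (k : ℕ) :
    correction K e b p x y i k ∈ zetaForms K e b := by
  refine neg_mem (sum_mem fun I _ => sum_mem fun k _ => Submodule.smul_mem _ _ (add_mem ?_ ?_)) <;>
  · split_ifs
    · exact zeta_mem_zetaForms _ _
    · exact zero_mem _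

lemma RollingSystem.stdCoeff_mem_zetaForms (S : RollingSystem e b p) (x y : Sym2 ι → ι) (m : ℕ)
    (d : Coord e) : S.stdCoeff x y m d ∈ zetaForms K e b := by
  have h : ∀ c c' : Coord e, tailForm K e b d.1 d.2 c c' ∈ zetaForms K e b := fun c c' => by
    unfold tailForm
    split_ifs
    · exact zeta_mem_zetaForms _ _
    · exact zero_mem _
  refine add_mem (quadForm_mem (fun c c' => add_mem (h c c') (h c' c)) _) ?_
  split_ifs
  · exact correction_mem_zetaForms x y _ _
  · exact zero_mem _

/-- The `K`-coefficients of the linear forms `stdCoeff`. -/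
def RollingSystem.stdCoeffs (S : RollingSystem e b p) (x y : Sym2 ι → ι) (m : ℕ) (d : Coord e) :
    ScrollParam e → K :=
  (mem_zetaForms.1 (S.stdCoeff_mem_zetaForms x y m d)).choose

lemma RollingSystem.linForm_stdCoeffs (S : RollingSystem e b p) (x y : Sym2 ι → ι) (m : ℕ)
    (d : Coord e) : linForm e b (S.stdCoeffs x y m d) = S.stdCoeff x y m d :=
  (mem_zetaForms.1 (S.stdCoeff_mem_zetaForms x y m d)).choose_spec

/-- The standard infinitesimal deformation of given additional equations, whose base equations are
the `π_m`. -/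
def RollingSystem.stdDeformation (S : RollingSystem e b p) {x y : Sym2 ι → ι}
    (hxy : ∀ I, s(x I, y I) = I) : InfDeformation S where
  coeffs := S.stdCoeffs x y
  lifts m hm := by
    rw [S.lifts_iff _ hm]
    refine ⟨fun i => ?_, fun α => ?_, fun i => ?_⟩
    · rw [pertCoeff, S.linForm_stdCoeffs, S.stdCoeff_succ_zero x y hm, pureCoeff_succ_zero, add_zero,
        sub_self]
      exact zero_mem _
    · rw [pertCoeff, pertCoeff, S.linForm_stdCoeffs, S.linForm_stdCoeffs, S.stdCoeff_succ x y hm,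
        pureCoeff_succ_botCoord]
      convert zero_mem (liftingIdeal e b p) using 1
      ring
    · rw [pertCoeff, S.linForm_stdCoeffs, S.stdCoeff_last hxy hm, pureCoeff_last hm, add_zero]
      split_ifs with h
      · exact Ideal.subset_span ⟨i, m - e i, by omega, by omega, rfl⟩
      · exact zero_mem _

lemma InfDeformation.baseEq_eq {S : RollingSystem e b p} (D : InfDeformation S) (m : ℕ) :
    D.baseEq m = ∑ d : Coord e, linForm e b (D.coeffs m d) * zeta K e b d.1 d.2
      - aeval (fun d : Coord e => zeta K e b d.1 (d.2 : ℕ)) (S.eqn m)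
      + ∑ i, ∑ j ∈ Finset.range (e i + 1 - b), rho K e b i j * zeta K e b i (j + m) := by
  rw [baseEq, perturbation_eq]
  simp only [map_sum, map_mul, eval_C, eval_X, pertCoeff, add_mul, Finset.sum_add_distrib]
  rw [add_sub_right_comm]
  congr 1
  rw [Fintype.sum_sigma]
  refine Finset.sum_congr rfl fun i _ => ?_
  rw [← sum_shift_mul (n := e i) (b := b) m (rho K e b i) (zeta K e b i)
    (fun j hj => rho_eq_zero K e b hj) fun j hj => zeta_eq_zero K e b hj.le]
  rfl

lemma RollingSystem.baseEq_stdDeformation (S : RollingSystem e b p) {x y : Sym2 ι → ι}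
    (hxy : ∀ I, s(x I, y I) = I) {m : ℕ} (hm : 1 ≤ m) (hmb : m < b) :
    (S.stdDeformation hxy).baseEq m = basePoly e b p x y (rho K e b) m := by
  rw [InfDeformation.baseEq_eq, basePoly, ← S.sum_stdCoeff_mul_zeta hxy hm hmb]
  simp only [stdDeformation, linForm_stdCoeffs]

end StandardDeformation

/-! ### Comparison with the standard deformation -/

section Comparison

/-- For `j < m` the diagonal through `(m, j)` starts at position `0` at the positive level `m - j`,
where the value lies in `J`. -/
lemma mem_of_lt_of_diagonal {ι A : Type*} [CommRing A] {e : ι → ℕ} {b : ℕ} {J : Ideal A}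
    {δ : ℕ → Coord e → A} (h0 : ∀ m < b, ∀ i, δ (m + 1) ⟨i, 0⟩ ∈ J)
    (h1 : ∀ m < b, ∀ α : Column e, δ (m + 1) (botCoord α) - δ m (topCoord α) ∈ J)
    {m : ℕ} (hm : m ≤ b) {i : ι} {j : Fin (e i + 1)} (hj : (j : ℕ) < m) : δ m ⟨i, j⟩ ∈ J := by
  induction m generalizing j with
  | zero => omega
  | succ m ih =>
    induction j using Fin.cases with
    | zero => exact h0 m hm i
    | succ j =>
      have h2 := ih (by omega) (j := j.castSucc) (by simpa using hj)
      exact (J.sub_mem_iff_left h2).1 (h1 m hm ⟨i, j⟩)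

lemma sub_mem_of_diagonal {ι A : Type*} [CommRing A] {e : ι → ℕ} {b : ℕ} {J : Ideal A}
    {δ : ℕ → Coord e → A}
    (h1 : ∀ m < b, ∀ α : Column e, δ (m + 1) (botCoord α) - δ m (topCoord α) ∈ J)
    {m : ℕ} (hm : m ≤ b) {i : ι} {k : ℕ} (hk : k + m < e i + 1) :
    δ m ⟨i, ⟨k + m, hk⟩⟩ - δ 0 ⟨i, ⟨k, by omega⟩⟩ ∈ J := by
  induction m with
  | zero => simp
  | succ m ih =>
    have h2 := ih (by omega) (by omega)
    have h3 := h1 m hm ⟨i, ⟨k + m, by omega⟩⟩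
    convert J.add_mem h3 h2 using 1
    exact (sub_add_sub_cancel _ (δ m ⟨i, ⟨k + m, by omega⟩⟩) _).symm

variable {K : Type*} [Field K] {ι : Type*} [Fintype ι] [DecidableEq ι] {e : ι → ℕ} {b : ℕ}
  {p : Sym2 ι → ℕ → K} {S : RollingSystem e b p}

/-- The condition, modulo `J`, on the coefficients of the perturbations of an infinitesimal
deformation. -/
def InfDeformation.LiftsModulo (D : InfDeformation S) (J : Ideal (Params K e b)) : Prop :=
  ∀ m < b, IsLift J (pertCoeff D.coeffs m) fun d => pertCoeff D.coeffs (m + 1) d - S.shiftCoeff m d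

lemma InfDeformation.liftsModulo_liftingIdeal (D : InfDeformation S) :
    D.LiftsModulo (liftingIdeal e b p) :=
  fun m hm => (S.lifts_iff _ hm).1 (D.lifts m hm)

lemma InfDeformation.LiftsModulo.mono {D : InfDeformation S} {J J' : Ideal (Params K e b)}
    (h : D.LiftsModulo J) (hJ : J ≤ J') : D.LiftsModulo J' :=
  fun m hm => ⟨fun i => hJ ((h m hm).first i), fun α => hJ ((h m hm).column α),
    fun i => hJ ((h m hm).last i)⟩

lemma InfDeformation.LiftsModulo.sub_stdCoeff_zero_mem {D : InfDeformation S}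
    {J : Ideal (Params K e b)} (h : D.LiftsModulo J) (x y : Sym2 ι → ι) {m : ℕ} (hm : m < b)
    (i : ι) : linForm e b (D.coeffs (m + 1) ⟨i, 0⟩) - S.stdCoeff x y (m + 1) ⟨i, 0⟩ ∈ J := by
  have h1 := (h m hm).first i
  rwa [pertCoeff, pureCoeff_succ_zero, add_zero, ← S.stdCoeff_succ_zero x y hm] at h1

lemma InfDeformation.LiftsModulo.sub_stdCoeff_succ_mem {D : InfDeformation S}
    {J : Ideal (Params K e b)} (h : D.LiftsModulo J) (x y : Sym2 ι → ι) {m : ℕ} (hm : m < b)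
    (α : Column e) :
    (linForm e b (D.coeffs (m + 1) (botCoord α)) - S.stdCoeff x y (m + 1) (botCoord α))
      - (linForm e b (D.coeffs m (topCoord α)) - S.stdCoeff x y m (topCoord α)) ∈ J := by
  have h1 := (h m hm).column α
  rw [pertCoeff, pertCoeff, pureCoeff_succ_botCoord] at h1
  rw [S.stdCoeff_succ x y hm]
  convert h1 using 1
  ring

lemma InfDeformation.LiftsModulo.linForm_last_mem {D : InfDeformation S}
    {J : Ideal (Params K e b)} (h : D.LiftsModulo J) {m : ℕ} (hm : m < b) (i : ι) :
    linForm e b (D.coeffs m ⟨i, Fin.last _⟩) ∈ J := by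
  have h1 := (h m hm).last i
  rwa [pertCoeff, pureCoeff_last hm, add_zero] at h1

/-- For `m = n + e i < b` the last position lies on a diagonal where the difference from the
standard deformation is in `J`. The deformation itself has its last coefficient in `J`, so the
standard one does too, and that coefficient is the lifting form. -/
lemma InfDeformation.LiftsModulo.liftingIdeal_le {D : InfDeformation S}
    {J : Ideal (Params K e b)} (h : D.LiftsModulo J) {x y : Sym2 ι → ι}
    (hxy : ∀ I, s(x I, y I) = I) : liftingIdeal e b p ≤ J := by
  rw [liftingIdeal, Ideal.span_le]
  rintro _ ⟨i, n, hn, hnb, rfl⟩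
  have h1 := mem_of_lt_of_diagonal
    (δ := fun m d => linForm e b (D.coeffs m d) - S.stdCoeff x y m d)
    (fun m hm i => h.sub_stdCoeff_zero_mem x y hm i)
    (fun m hm α => h.sub_stdCoeff_succ_mem x y hm α) hnb.le (i := i) (j := Fin.last _)
    (by rw [Fin.val_last]; omega)
  have h2 := (J.sub_mem_iff_right (h.linForm_last_mem hnb i)).1 h1
  rwa [S.stdCoeff_last hxy hnb, if_pos (by omega), Nat.add_sub_cancel] at h2

/-- Up to a linear coordinate transformation in the `ρ`, the base equations of an infinitesimal
deformation are the `π_m`, modulo the lifting conditions. -/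
lemma InfDeformation.exists_baseEq_sub_basePoly_mem (D : InfDeformation S) {x y : Sym2 ι → ι}
    (hxy : ∀ I, s(x I, y I) = I) :
    ∃ τ : ι → ℕ → ScrollParam e → K, ∀ m, 1 ≤ m → m < b →
      D.baseEq m - basePoly e b p x y (fun i j => rho K e b i j + linForm e b (τ i j)) m
        ∈ liftingIdeal e b p := by
  have hD := D.liftsModulo_liftingIdeal
  let δ : ℕ → Coord e → Params K e b := fun m d => linForm e b (D.coeffs m d) - S.stdCoeff x y m d
  -- The difference from the standard deformation at level `0`, kept only on the diagonals that
  -- carry a parameter `ρ_{i,k}`.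
  let τ : ι → ℕ → ScrollParam e → K := fun i k => if h : k + b ≤ e i then
    D.coeffs 0 ⟨i, ⟨k, by omega⟩⟩ - S.stdCoeffs x y 0 ⟨i, ⟨k, by omega⟩⟩ else 0
  have h0 : ∀ m < b, ∀ i, δ (m + 1) ⟨i, 0⟩ ∈ liftingIdeal e b p :=
    fun m hm i => hD.sub_stdCoeff_zero_mem x y hm i
  have h1 : ∀ m < b, ∀ α : Column e,
      δ (m + 1) (botCoord α) - δ m (topCoord α) ∈ liftingIdeal e b p :=
    fun m hm α => hD.sub_stdCoeff_succ_mem x y hm α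
  have hlast : ∀ m < b, ∀ i, δ m ⟨i, Fin.last _⟩ ∈ liftingIdeal e b p := by
    intro m hm i
    refine Ideal.sub_mem _ (hD.linForm_last_mem hm i) ?_
    have h2 := (S.stdDeformation hxy).liftsModulo_liftingIdeal.linForm_last_mem hm i
    rwa [RollingSystem.stdDeformation, S.linForm_stdCoeffs] at h2
  have hτ : ∀ i k (hk : k < e i + 1),
      δ 0 ⟨i, ⟨k, hk⟩⟩ - linForm e b (τ i k) ∈ liftingIdeal e b p := by
    intro i k hk
    by_cases h : k + b ≤ e i
    · simp only [τ, dif_pos h, linForm_sub, S.linForm_stdCoeffs, δ, sub_self]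
      exact zero_mem _
    · simp only [τ, dif_neg h, linForm_zero, sub_zero]
      -- As `e i < k + b`, this diagonal reaches the last position at level `e i - k < b`, where the
      -- difference lies in `L`.
      have h2 := sub_mem_of_diagonal h1 (m := e i - k) (by omega) (i := i) (k := k) (by omega)
      refine ((liftingIdeal e b p).sub_mem_iff_right ?_).1 h2
      convert hlast (e i - k) (by omega) i using 3
      rw [Fin.ext_iff]
      simp only [Fin.val_last]
      omega
  refine ⟨τ, fun m hm hmb => ?_⟩
  have h3 : D.baseEq m - basePoly e b p x y (fun i j => rho K e b i j + linForm e b (τ i j)) m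
      = ∑ d : Coord e, δ m d * zeta K e b d.1 d.2
        - ∑ i, ∑ j ∈ Finset.range (e i + 1 - b), linForm e b (τ i j) * zeta K e b i (j + m) := by
    rw [D.baseEq_eq, basePoly, ← S.sum_stdCoeff_mul_zeta hxy hm hmb]
    simp only [δ, add_mul, sub_mul, Finset.sum_add_distrib, Finset.sum_sub_distrib]
    ring
  rw [h3, Fintype.sum_sigma, ← Finset.sum_sub_distrib]
  refine Ideal.sum_mem _ fun i _ => ?_
  rw [← sum_shift_mul (n := e i) (b := b) m (fun j => linForm e b (τ i j)) (zeta K e b i)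
    (fun j hj => by simp only [τ, dif_neg hj.not_ge, linForm_zero])
    (fun j hj => zeta_eq_zero K e b hj.le), ← Finset.sum_sub_distrib]
  refine Ideal.sum_mem _ fun j _ => ?_
  rw [← sub_mul]
  refine Ideal.mul_mem_right _ _ ?_
  split_ifs with hj
  · have h4 := sub_mem_of_diagonal h1 hmb.le (i := i) (k := j - m) (by omega)
    have h5 := Ideal.add_mem _ h4 (hτ i (j - m) (by omega))
    rw [sub_add_sub_cancel] at h5
    convert h5 using 4
    rw [Fin.ext_iff]
    simp only
    omega
  · rw [sub_zero]
    exact mem_of_lt_of_diagonal h0 h1 hmb.le (not_le.1 hj)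

end Comparison

/-! ### Extending infinitesimal deformations -/

section Parametrization

variable (K : Type*) [Field K] {ι : Type*} (e : ι → ℕ) (b : ℕ)

/-- On the chart `s = 1` with coordinate `t` the deformed scroll is parametrized by
`z_{i,j} = t ^ j z_i + chartShift i j`. -/
def chartShift (i : ι) : ℕ → Polynomial (Params K e b)
  | 0 => 0
  | j + 1 => Polynomial.X * chartShift i j - Polynomial.C (zeta K e b i (j + 1))

/-- The parametrization of the deformed scroll on the chart `s = 1`. -/
def chart : MvPolynomial (Coord e) (Params K e b) →ₐ[Params K e b]
    MvPolynomial ι (Polynomial (Params K e b)) :=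
  aeval fun d => C (Polynomial.X ^ (d.2 : ℕ)) * X d.1 + C (chartShift K e b d.1 d.2)

lemma chart_C (a : Params K e b) : chart K e b (C a) = C (Polynomial.C a) := by
  rw [chart, aeval_C]
  rfl

lemma chart_defBot (α : Column e) :
    chart K e b (defBot K e b α) = C Polynomial.X * chart K e b (zTop (Params K e b) e α) := by
  rw [defBot, map_add, chart_C]
  simp only [chart, zBot, zTop, aeval_X, Fin.val_succ, Fin.val_castSucc, chartShift, map_sub,
    map_mul, map_pow]
  ring

/-- On the chart each bottom entry is `t` times the entry above it, so the minors vanish identically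
and only `J` survives. -/
lemma chart_mem {J : Ideal (Params K e b)} {q : MvPolynomial (Coord e) (Params K e b)}
    (hq : q ∈ defScrollIdeal K e b ⊔ J.map C) :
    chart K e b q ∈ (J.map (Polynomial.C : _ →+* Polynomial (Params K e b))).map
      (C : _ →+* MvPolynomial ι (Polynomial (Params K e b))) := by
  have h1 : defScrollIdeal K e b ⊔ J.map C ≤ Ideal.comap (chart K e b)
      ((J.map (Polynomial.C : _ →+* Polynomial (Params K e b))).map
        (C : _ →+* MvPolynomial ι (Polynomial (Params K e b)))) := by
    refine sup_le ?_ ?_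
    · rw [defScrollIdeal, Ideal.span_le]
      rintro _ ⟨α, β, rfl⟩
      rw [SetLike.mem_coe, Ideal.mem_comap, map_sub, map_mul, map_mul, chart_defBot, chart_defBot]
      convert zero_mem (Ideal.map _ _) using 1
      ring
    · rw [Ideal.map_le_iff_le_comap]
      intro a ha
      rw [Ideal.mem_comap, Ideal.mem_comap, chart_C]
      exact Ideal.mem_map_of_mem _ (Ideal.mem_map_of_mem _ ha)
  exact h1 hq

lemma mem_of_X_mul_mem {σ R : Type*} [CommRing R] {I : Ideal R} (i : σ) {q : MvPolynomial σ R}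
    (h : X i * q ∈ I.map (C : R →+* MvPolynomial σ R)) : q ∈ I.map (C : R →+* MvPolynomial σ R) := by
  rw [mem_map_C_iff] at h ⊢
  intro s
  have h1 := h (Finsupp.single i 1 + s)
  rwa [coeff_X_mul] at h1

/-- The `2 × 2` minors which generate the ideal of the deformed scroll. -/
lemma minor_mem (α β : Column e) :
    zTop (Params K e b) e α * defBot K e b β - defBot K e b α * zTop (Params K e b) e β
      ∈ defScrollIdeal K e b :=
  Ideal.subset_span ⟨α, β, rfl⟩

variable [Fintype ι]

lemma chart_sum (F : Coord e → Params K e b) :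
    chart K e b (∑ d, C (F d) * X d) = ∑ i, C (blockPoly F i) * X i
      + C (∑ d : Coord e, Polynomial.C (F d) * chartShift K e b d.1 d.2) := by
  simp only [map_sum, map_mul, chart_C, blockPoly, Finset.sum_mul]
  rw [← Fintype.sum_sigma', ← Finset.sum_add_distrib]
  refine Finset.sum_congr rfl fun d _ => ?_
  simp only [chart, aeval_X, map_pow]
  ring

end Parametrization

section Extension

variable {K : Type*} [Field K] {ι : Type*} [Fintype ι] {e : ι → ℕ} {b : ℕ}

lemma sum_coord_eq_zero_add {M : Type*} [AddCommMonoid M] (g : Coord e → M) :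
    ∑ d, g d = ∑ i, g ⟨i, 0⟩ + ∑ α : Column e, g (botCoord α) := by
  rw [Fintype.sum_sigma, Fintype.sum_sigma, ← Finset.sum_add_distrib]
  exact Finset.sum_congr rfl fun i _ => Fin.sum_univ_succ _

lemma sum_coord_eq_add_last {M : Type*} [AddCommMonoid M] (g : Coord e → M) :
    ∑ d, g d = ∑ α : Column e, g (topCoord α) + ∑ i, g ⟨i, Fin.last _⟩ := by
  rw [Fintype.sum_sigma, Fintype.sum_sigma, ← Finset.sum_add_distrib]
  exact Finset.sum_congr rfl fun i _ => Fin.sum_univ_castSucc _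

/-- Over the deformed scroll, linear forms which satisfy `s H = t F` on the scroll itself modulo `J`
fail to do so by a constant. -/
lemma IsLift.mem {J : Ideal (Params K e b)} {F H : Coord e → Params K e b} (h : IsLift J F H)
    (β : Column e) :
    (∑ d, C (H d) * X d) * zTop (Params K e b) e β - (∑ d, C (F d) * X d) * defBot K e b β
      + C (∑ α : Column e, F (topCoord α) * zeta K e b α.1 (α.2 + 1)) * zTop (Params K e b) e β
      ∈ defScrollIdeal K e b ⊔ J.map C := by
  have hC : ∀ {a : Params K e b}, a ∈ J → ∀ q : MvPolynomial (Coord e) (Params K e b),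
      C a * q ∈ defScrollIdeal K e b ⊔ J.map C :=
    fun ha q => Ideal.mul_mem_right _ _ (Ideal.mem_sup_right (Ideal.mem_map_of_mem _ ha))
  -- Split `H` by first and bottom coordinates and `F` by top and last ones. Exchanging `z_α` times
  -- the bottom of `β` for the bottom of `α` times `z_β` costs a minor; the shift `ζ_{α+1}` in the
  -- bottom of `α` produces the constant.
  have key : (∑ d, C (H d) * X d) * zTop (Params K e b) e β
      - (∑ d, C (F d) * X d) * defBot K e b β
      + C (∑ α : Column e, F (topCoord α) * zeta K e b α.1 (α.2 + 1)) * zTop (Params K e b) e β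
      = ∑ i, C (H ⟨i, 0⟩) * (X ⟨i, 0⟩ * zTop (Params K e b) e β)
        + ∑ α : Column e, C (H (botCoord α) - F (topCoord α)) *
          (X (botCoord α) * zTop (Params K e b) e β)
        - ∑ i, C (F ⟨i, Fin.last _⟩) * (X ⟨i, Fin.last _⟩ * defBot K e b β)
        - ∑ α : Column e, C (F (topCoord α)) * (zTop (Params K e b) e α * defBot K e b β
            - defBot K e b α * zTop (Params K e b) e β) := by
    have h1 : ∀ α : Column e, defBot K e b α = X (botCoord α) + C (zeta K e b α.1 (α.2 + 1)) :=
      fun _ => rfl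
    have h2 : ∀ α : Column e, zTop (Params K e b) e α = X (topCoord α) := fun _ => rfl
    rw [sum_coord_eq_zero_add (fun d => C (H d) * X d),
      sum_coord_eq_add_last (fun d => C (F d) * X d)]
    generalize hβ : defBot K e b β = w
    generalize hβ' : zTop (Params K e b) e β = z
    simp only [h1, h2, map_sum, map_mul, map_sub, add_mul, sub_mul, mul_sub, mul_add,
      Finset.sum_mul, Finset.sum_sub_distrib, Finset.sum_add_distrib, mul_assoc]
    ring
  rw [key]
  refine Ideal.sub_mem _ (Ideal.sub_mem _ (Ideal.add_mem _
    (Ideal.sum_mem _ fun i _ => hC (h.first i) _)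
    (Ideal.sum_mem _ fun α _ => hC (h.column α) _))
    (Ideal.sum_mem _ fun i _ => hC (h.last i) _))
    (Ideal.sum_mem _ fun α _ => Ideal.mul_mem_left _ _ (Ideal.mem_sup_left (minor_mem K e b α β)))

/-- Conversely, a relation on the deformed scroll can be tested on a column `z_{i,0}, z_{i,1}`. -/
lemma isLift_of_mem {J : Ideal (Params K e b)} {F H : Coord e → Params K e b}
    {a a' : Params K e b} {β : Column e} (hβ : (β.2 : ℕ) = 0)
    (h : ((∑ d, C (H d) * X d) + C a') * zTop (Params K e b) e β
      - ((∑ d, C (F d) * X d) + C a) * defBot K e b β ∈ defScrollIdeal K e b ⊔ J.map C) :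
    IsLift J F H ∧ a' - ∑ α : Column e, F (topCoord α) * zeta K e b α.1 (α.2 + 1) ∈ J
      ∧ a ∈ J := by
  -- In a column with `j = 0` the top entry becomes the variable `z_i` itself, which can be
  -- cancelled modulo `J`.
  have htop : chart K e b (zTop (Params K e b) e β) = X β.1 := by
    simp [chart, zTop, hβ, chartShift]
  have hF : IsLift J F H := by
    have h1 := chart_mem K e b h
    rw [map_sub, map_mul, map_mul, map_add, map_add, chart_defBot, htop, chart_sum, chart_sum,
      chart_C, chart_C] at h1
    apply isLift_of_blockPoly_mem
    refine (mem_of_sum_C_mul_X_add_C_mem (q₀ :=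
      (∑ d : Coord e, Polynomial.C (H d) * chartShift K e b d.1 d.2) + Polynomial.C a'
      - Polynomial.X * ((∑ d : Coord e, Polynomial.C (F d) * chartShift K e b d.1 d.2)
        + Polynomial.C a)) (mem_of_X_mul_mem β.1 ?_)).1
    convert h1 using 1
    simp only [map_sub, map_add, map_mul, sub_mul, Finset.sum_sub_distrib, mul_assoc,
      ← Finset.mul_sum]
    ring
  -- Once the linear parts are removed, `(a' - σ) - t a` remains as the factor of `z_i`; its
  -- coefficients of `1` and `t` give the two remaining claims.
  have h2 := chart_mem K e b (Ideal.sub_mem _ h (hF.mem β))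
  set σ := ∑ α : Column e, F (topCoord α) * zeta K e b α.1 (α.2 + 1)
  have h4 := (mem_of_sum_C_mul_X_add_C_mem (ι := ι) (q := 0)
    (q₀ := Polynomial.C (a' - σ) - Polynomial.X * Polynomial.C a)
    (mem_of_X_mul_mem β.1 (by
      convert h2 using 1
      simp only [Pi.zero_apply, map_zero, zero_mul, Finset.sum_const_zero, zero_add, map_sub, map_add,
        map_mul, chart_defBot, htop, chart_C]
      ring))).2
  rw [Ideal.mem_map_C_iff] at h4
  exact ⟨hF, by simpa using h4 0, by simpa using h4 1⟩

variable [DecidableEq ι] {p : Sym2 ι → ℕ → K} {S : RollingSystem e b p}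

lemma RollingSystem.aeval_zeta_eqn_succ (S : RollingSystem e b p) {m : ℕ} (hm : m < b) :
    aeval (fun d : Coord e => zeta K e b d.1 (d.2 : ℕ)) (S.eqn (m + 1))
      = ∑ d : Coord e, S.shiftCoeff m d * zeta K e b d.1 d.2 := by
  rw [S.eqn_succ_eq_sum hm]
  simp only [map_sum, map_smul, map_mul, aeval_X, shiftCoeff, Finset.sum_mul]
  rw [Finset.sum_comm]
  refine Finset.sum_congr rfl fun d _ => Finset.sum_congr rfl fun α _ => ?_
  rw [smul_mul_assoc, mul_comm, Fin.val_succ]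

lemma InfDeformation.baseEq_succ (D : InfDeformation S) {m : ℕ} (hm : m < b) :
    D.baseEq (m + 1) = ∑ d : Coord e,
      (pertCoeff D.coeffs (m + 1) d - S.shiftCoeff m d) * zeta K e b d.1 d.2 := by
  rw [baseEq, perturbation_eq, S.aeval_zeta_eqn_succ hm]
  simp only [map_sum, map_mul, eval_C, eval_X, sub_mul, Finset.sum_sub_distrib]

/-- Since `P_{m+1} = ∑ p_{α,m} z_{α+1}`, subtracting `P_{m+1}(ζ)` amounts to subtracting the shift
term from `P'_{m+1}` at `z = ζ`; the recursion then replaces what is left by the coefficients of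
`P'_m`. -/
lemma InfDeformation.LiftsModulo.baseEq_succ_sub_mem {D : InfDeformation S}
    {J : Ideal (Params K e b)} (h : D.LiftsModulo J) {m : ℕ} (hm : m < b) :
    D.baseEq (m + 1) - ∑ α : Column e,
      pertCoeff D.coeffs m (topCoord α) * zeta K e b α.1 (α.2 + 1) ∈ J := by
  rw [D.baseEq_succ hm, sum_coord_eq_zero_add, add_sub_assoc, ← Finset.sum_sub_distrib]
  refine J.add_mem (J.sum_mem fun i _ => ?_) (J.sum_mem fun α _ => ?_)
  · exact J.mul_mem_right _ ((h m hm).first i)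
  · rw [Fin.val_succ, ← sub_mul]
    exact J.mul_mem_right _ ((h m hm).column α)

/-- The lifted rolling factors relations, with the equations of the original scroll removed. -/
lemma InfDeformation.relation_mem_iff (D : InfDeformation S) (J : Ideal (Params K e b))
    (c : ℕ → Params K e b) {m : ℕ} (hm : m < b) (β : Column e) :
    (map C (S.eqn (m + 1)) + perturbation e b D.coeffs (m + 1) + C (c (m + 1)))
          * zTop (Params K e b) e β
        - (map C (S.eqn m) + perturbation e b D.coeffs m + C (c m)) * defBot K e b β
      ∈ defScrollIdeal K e b ⊔ J.map (C : Params K e b →+* MvPolynomial (Coord e) (Params K e b)) ↔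
    ((∑ d, C (pertCoeff D.coeffs (m + 1) d - S.shiftCoeff m d) * X d) + C (c (m + 1)))
          * zTop (Params K e b) e β
        - ((∑ d, C (pertCoeff D.coeffs m d) * X d) + C (c m)) * defBot K e b β
      ∈ defScrollIdeal K e b ⊔ J.map (C : Params K e b →+* MvPolynomial (Coord e) (Params K e b)) := by
  -- Adding this combination of minors cancels `P_m` and `P_{m+1}` and leaves only the shift term `∑
  -- p_{α,m} ζ_{α+1}`, multiplied by `z_β`.
  have h1 : ∑ α, map C (S.fac m α) * (zTop (Params K e b) e α * defBot K e b β
      - defBot K e b α * zTop (Params K e b) e β)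
      ∈ defScrollIdeal K e b ⊔ J.map (C : Params K e b →+* MvPolynomial (Coord e) (Params K e b)) :=
    Ideal.sum_mem _ fun α _ => Ideal.mul_mem_left _ _ (Ideal.mem_sup_left (minor_mem K e b α β))
  rw [← Submodule.add_mem_iff_left _ h1]
  refine Eq.to_iff (congrArg (· ∈ _) ?_)
  have h2 : ∀ α, map (C : K →+* Params K e b) (zTop K e α) = zTop (Params K e b) e α :=
    fun α => map_X _ _
  have h3 : ∀ α, map (C : K →+* Params K e b) (zBot K e α) = zBot (Params K e b) e α :=
    fun α => map_X _ _
  have h4 : ∑ d, C (pertCoeff D.coeffs (m + 1) d - S.shiftCoeff m d) * X d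
      = perturbation e b D.coeffs (m + 1)
        - ∑ α, map C (S.fac m α) * C (zeta K e b α.1 ((α.2 : ℕ) + 1)) := by
    rw [S.sum_fac_mul_zeta hm, perturbation_eq]
    simp only [map_sub, sub_mul, Finset.sum_sub_distrib]
  rw [h4, ← perturbation_eq, S.eqn_eq m hm, S.eqn_succ m hm]
  simp only [map_sum, map_mul, h2, h3]
  generalize hw : defBot K e b β = w
  have h5 : ∀ α, defBot K e b α
      = zBot (Params K e b) e α + C (zeta K e b α.1 ((α.2 : ℕ) + 1)) := fun _ => rfl
  simp only [h5, add_mul, sub_mul, mul_sub, mul_add, Finset.sum_sub_distrib,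
    Finset.sum_add_distrib, Finset.sum_mul, mul_assoc]
  ring

/-- The maximal extension of an infinitesimal deformation is defined by the lifting conditions and
the base equations. -/
lemma InfDeformation.extendsOver_iff (D : InfDeformation S) {x y : Sym2 ι → ι}
    (hxy : ∀ I, s(x I, y I) = I) (J : Ideal (Params K e b)) :
    D.ExtendsOver J ↔ liftingIdeal e b p ≤ J ∧ ∀ m, 1 ≤ m → m < b → D.baseEq m ∈ J := by
  constructor
  · rintro ⟨c, hc⟩
    -- Without columns the relations are vacuous, but then every `ζ_{i,j}` is zero, and with them
    -- the lifting forms and base equations.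
    by_cases he : ∀ i, e i = 0
    · have hz : ∀ i j, zeta K e b i j = 0 := fun i j =>
        zeta_eq_zero K e b ((he i).trans_le (Nat.zero_le j))
      constructor
      · rw [liftingIdeal, Ideal.span_le]
        rintro _ ⟨i, n, -, -, rfl⟩
        simp only [liftingForm, hz, mul_zero, Finset.sum_const_zero]
        exact zero_mem J
      · rintro (_ | m) hm hmb
        · omega
        · rw [D.baseEq_succ (by omega)]
          simp only [hz, mul_zero, Finset.sum_const_zero]
          exact zero_mem J
    · push Not at he
      obtain ⟨i, hi⟩ := he
      have h1 : ∀ m < b, IsLift J (pertCoeff D.coeffs m)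
            (fun d => pertCoeff D.coeffs (m + 1) d - S.shiftCoeff m d)
          ∧ c (m + 1) - ∑ α : Column e,
            pertCoeff D.coeffs m (topCoord α) * zeta K e b α.1 (α.2 + 1) ∈ J
          ∧ c m ∈ J := fun m hm =>
        isLift_of_mem (β := ⟨i, ⟨0, Nat.pos_of_ne_zero hi⟩⟩) rfl
          ((D.relation_mem_iff J c hm _).1 (hc m hm _))
      have hD : D.LiftsModulo J := fun m hm => (h1 m hm).1
      refine ⟨hD.liftingIdeal_le hxy, ?_⟩
      rintro (_ | m) hm hmb
      · omega
      · have h2 := (J.sub_mem_iff_right (h1 (m + 1) hmb).2.2).1 (h1 m (by omega)).2.1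
        exact (J.sub_mem_iff_left h2).1 (hD.baseEq_succ_sub_mem (by omega))
  · rintro ⟨hL, hJ⟩
    have hD := D.liftsModulo_liftingIdeal.mono hL
    let τ : ℕ → Params K e b := fun m =>
      ∑ α : Column e, pertCoeff D.coeffs m (topCoord α) * zeta K e b α.1 (α.2 + 1)
    -- The term `c_b` occurs in one relation only, so it may take whatever value that relation
    -- requires.
    obtain ⟨c, hc, hcb⟩ : ∃ c : ℕ → Params K e b, (∀ m < b, c m = 0) ∧ c b = τ (b - 1) :=
      ⟨fun m => if m = b then τ (b - 1) else 0, fun m hm => if_neg hm.ne, if_pos rfl⟩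
    refine ⟨c, fun m hm β => (D.relation_mem_iff J c hm β).2 ?_⟩
    have h1 : c (m + 1) - τ m ∈ J := by
      rcases Nat.lt_or_eq_of_le (Nat.succ_le_of_lt hm) with h | h
      · rw [hc _ h, zero_sub, J.neg_mem_iff]
        exact (J.sub_mem_iff_right (hJ (m + 1) (Nat.le_add_left 1 m) h)).1
          (hD.baseEq_succ_sub_mem hm)
      · subst h
        rw [hcb, Nat.succ_sub_one, sub_self]
        exact zero_mem J
    have h2 : C (c (m + 1) - τ m) * zTop (Params K e b) e β
        ∈ defScrollIdeal K e b ⊔ J.map C :=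
      Ideal.mul_mem_right _ _ (Ideal.mem_sup_right (Ideal.mem_map_of_mem _ h1))
    convert Ideal.add_mem _ ((hD m hm).mem β) h2 using 1
    rw [hc m hm, map_sub, map_zero]
    ring

end Extension

end RollingFactors

end

theorem theorem3p4 {K : Type*} [Field K] {ι : Type*} [Fintype ι] [DecidableEq ι]
    (e : ι → ℕ) (b : ℕ) (p : Sym2 ι → ℕ → K)
    (x y : Sym2 ι → ι) (hxy : ∀ I, s(x I, y I) = I) (hle : ∀ I, e (y I) ≤ e (x I)) :
    (∃ (S : RollingFactors.RollingSystem e b p) (D : RollingFactors.InfDeformation S),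
      ∀ m, 1 ≤ m → m < b →
        D.baseEq m = RollingFactors.basePoly e b p x y (RollingFactors.rho K e b) m) ∧
    (∀ (S : RollingFactors.RollingSystem e b p) (D : RollingFactors.InfDeformation S),
      (∀ J : Ideal (RollingFactors.Params K e b),
        D.ExtendsOver J ↔
          RollingFactors.liftingIdeal e b p ≤ J ∧ ∀ m, 1 ≤ m → m < b → D.baseEq m ∈ J) ∧
      (∃ τ : ι → ℕ → RollingFactors.ScrollParam e → K, ∀ m, 1 ≤ m → m < b →
        D.baseEq m - RollingFactors.basePoly e b p x y
            (fun i j => RollingFactors.rho K e b i j + RollingFactors.linForm e b (τ i j)) m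
          ∈ RollingFactors.liftingIdeal e b p)) :=
  ⟨⟨RollingFactors.pathSystem e b p x y hxy,
      RollingFactors.RollingSystem.stdDeformation _ hxy, fun _ hm hmb =>
        RollingFactors.RollingSystem.baseEq_stdDeformation _ hxy hm hmb⟩,
    fun _ D => ⟨D.extendsOver_iff hxy, D.exists_baseEq_sub_basePoly_mem hxy⟩⟩
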